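/- Let $\mu\subseteq\lambda$ be partitions, identified with their Young diagrams, and let $s_{\lambda/\mu}=\sum_T x^T\in\mathbb{C}[[x_1,x_2,\dots]]$ be the skew Schur function, the sum being over all semistandard Young tableaux $T$ of shape $\lambda/\mu$ (positive integer entries, weakly increasing along rows from left to right, strictly increasing down columns), where $x^T=\prod_i x_i^{\#\{\text{entries of }T\text{ equal to }i\}}$. For a composition $\alpha=(\alpha_1,\dots,\alpha_l)$ (a finite, possibly empty, sequence of positive integers) put $M_\alpha=\sum_{1\le i_1<\dots<i_l}x_{i_1}^{\alpha_1}\cdots x_{i_l}^{\alpha_l}$ and $\pi(\alpha)=\prod_{i=1}^{l}(\alpha_1+\dots+\alpha_i)$. A coarsening $\beta=(\beta_1,\dots,\beta_k)$ of $\alpha$, written $\beta\succeq\alpha$, arises by cutting $\alpha$ into nonempty consecutive pieces $\alpha^{(1)},\dots,\alpha^{(k)}$ and letting $\beta_i$ be the sum of the parts of $\alpha^{(i)}$; put $\pi(\alpha,\beta)=\prod_{i=1}^{k}\pi(\alpha^{(i)})$. The (unnormalized) type 1 quasisymmetric power sum is $$\psi_\alpha=\sum_{\beta\succeq\alpha}\frac{1}{\pi(\alpha,\beta)}M_\beta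 .$$ A border strip is a (nonempty) connected skew shape containing no $2\times2$ square; its height is its number of rows minus one. A border-strip tableau of shape $\lambda/\mu$ and type $\alpha$ is an assignment of positive integers to the cells of $\lambda/\mu$ such that every row and column is weakly increasing, the integer $i$ appears $\alpha_i$ times ($\alpha_i=0$ for $i>l$), and for each $i$ that appears the set of cells occupied by $i$ is a border strip. Its height $\mathrm{ht}(T)$ is the sum of the heights of these border strips. Put $\chi^{\lambda/\mu}(\alpha)=\sum_T(-1)^{\mathrm{ht}(T)}$, over all border-strip tableaux $T$ of shape $\lambda/\mu$ and type $\alpha$. Then $\chi^{\lambda/\mu}(\alpha)\neq0$ for only finitely many compositions $\alpha$, and $$s_{\lambda/\mu}=\sum_{\alpha}\chi^{\lambda/\mu}(\alpha)\,\psi_\alpha ,$$ where the sum ranges over all compositions $\alpha$. -/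

import Mathlib

namespace PsiMN

/-! ### Formal power series in the variables indexed by the positive integers -/

/-- The formal power series `∑ a, x ^ (m a)`: the coefficient of `x ^ d` is the number of indices
`a` with `m a = d`. It is used only for families all of whose fibres are finite, see
`SkewSSYT.finite_fibre` and `finite_monomial_fibre`. -/
noncomputable def monomialSum {ι : Type} (m : ι → (ℕ+ →₀ ℕ)) : MvPowerSeries ℕ+ ℂ :=
  fun d => (Nat.card {a : ι // m a = d} : ℂ)

/-! ### Skew shapes and skew Schur functions -/

/-- The cells of `lam / mu`; the cell `(i, j)` lies in row `i` and column `j`, with rows numbered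
from top to bottom and columns from left to right. -/
def skewCells (lam mu : YoungDiagram) : Finset (ℕ × ℕ) := lam.cells \ mu.cells

/-- Semistandard Young tableaux of shape `lam / mu`, with positive integer entries. -/
@[ext]
structure SkewSSYT (lam mu : YoungDiagram) where
  entry : skewCells lam mu → ℕ+
  row_weak : ∀ c c' : skewCells lam mu, c.1.1 = c'.1.1 → c.1.2 ≤ c'.1.2 → entry c ≤ entry c'
  col_strict : ∀ c c' : skewCells lam mu, c.1.2 = c'.1.2 → c.1.1 < c'.1.1 → entry c < entry c'

/-- The exponent vector of `x ^ T`: the exponent of `x_i` is the number of entries of `T`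
equal to `i`. -/
noncomputable def SkewSSYT.content {lam mu : YoungDiagram} (T : SkewSSYT lam mu) : ℕ+ →₀ ℕ :=
  ∑ c : skewCells lam mu, Finsupp.single (T.entry c) 1

/-- The skew Schur function `s_{lam / mu} = ∑ T, x ^ T`. -/
noncomputable def skewSchur (lam mu : YoungDiagram) : MvPowerSeries ℕ+ ℂ :=
  monomialSum (fun T : SkewSSYT lam mu => T.content)

theorem mem_support_sum_single {ι : Type} [Fintype ι] (f : ι → ℕ+) (w : ι → ℕ) (i : ι)
    (hw : 0 < w i) : f i ∈ (∑ j, Finsupp.single (f j) (w j)).support := by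
  rw [Finsupp.mem_support_iff, Finsupp.finsetSum_apply]
  have h := Finset.single_le_sum (f := fun j => Finsupp.single (f j) (w j) (f i))
    (fun _ _ => Nat.zero_le _) (Finset.mem_univ i)
  simp only [Finsupp.single_eq_same] at h
  omega

theorem finite_of_entries {ι : Type} [Finite ι] (s : Finset ℕ+) :
    {f : ι → ℕ+ | ∀ i, f i ∈ s}.Finite :=
  Set.Finite.pi' (fun _ => s.finite_toSet)

theorem SkewSSYT.finite_fibre (lam mu : YoungDiagram) (d : ℕ+ →₀ ℕ) :
    {T : SkewSSYT lam mu | T.content = d}.Finite := by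
  refine Set.Finite.of_finite_image (f := SkewSSYT.entry) ?_ ?_
  · refine (finite_of_entries d.support).subset ?_
    rintro _ ⟨T, hT, rfl⟩ c
    rw [← (show T.content = d from hT)]
    exact mem_support_sum_single T.entry (fun _ => 1) c Nat.one_pos
  · intro T _ T' _ h
    exact SkewSSYT.ext h

/-! ### Monomial quasisymmetric functions and quasisymmetric power sums -/

/-- The monomial quasisymmetric function
`M_β = ∑_{i_1 < ... < i_k} x_{i_1} ^ β_1 ⋯ x_{i_k} ^ β_k`. -/
noncomputable def monomialQSym {n : ℕ} (β : Composition n) : MvPowerSeries ℕ+ ℂ :=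
  monomialSum (fun f : {f : Fin β.length → ℕ+ // StrictMono f} =>
    ∑ j, Finsupp.single (f.1 j) (β.blocksFun j))

theorem finite_monomial_fibre {n : ℕ} (β : Composition n) (d : ℕ+ →₀ ℕ) :
    {f : {f : Fin β.length → ℕ+ // StrictMono f} |
      ∑ j, Finsupp.single (f.1 j) (β.blocksFun j) = d}.Finite := by
  refine Set.Finite.of_finite_image (f := Subtype.val) ?_ Subtype.val_injective.injOn
  refine (finite_of_entries d.support).subset ?_
  rintro _ ⟨f, hf, rfl⟩ c
  rw [← (show ∑ j, Finsupp.single (f.1 j) (β.blocksFun j) = d from hf)]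
  exact mem_support_sum_single f.1 β.blocksFun c (β.one_le_blocksFun c)

/-- `π(a_1, ..., a_l) = a_1 (a_1 + a_2) ⋯ (a_1 + ⋯ + a_l)`. -/
def partialSumProd (a : List ℕ) : ℕ := ∏ i ∈ Finset.range a.length, (a.take (i + 1)).sum

/-- The coarsenings `β` of `α` are the compositions `α.gather b`, for `b` a composition of the
length of `α`: the parts of `α` are cut into consecutive groups of sizes `b_1, b_2, ...`, and
`β_i` is the sum of the `i`-th group `α^(i)`. This is `π(α, β) = ∏ i, π(α^(i))`. -/
def coarseningProd {n : ℕ} (α : Composition n) (b : Composition α.length) : ℕ :=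
  ((α.blocks.splitWrtComposition b).map partialSumProd).prod

/-- The (unnormalized) type 1 quasisymmetric power sum `ψ_α = ∑_{β ≽ α} π(α, β)⁻¹ M_β`, the sum
being over all coarsenings `β` of `α`. -/
noncomputable def psi {n : ℕ} (α : Composition n) : MvPowerSeries ℕ+ ℂ :=
  ∑ b : Composition α.length, ((coarseningProd α b : ℂ)⁻¹) • monomialQSym (α.gather b)

/-! ### Border strips and border-strip tableaux -/

/-- A border strip: a connected (hence nonempty) skew shape without a `2 × 2` square. Two cells are
adjacent in the Hasse graph of `ℕ × ℕ` exactly when they share an edge. -/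
def IsBorderStrip (S : Finset (ℕ × ℕ)) : Prop :=
  (∃ lam mu : YoungDiagram, mu ≤ lam ∧ S = skewCells lam mu) ∧
  ((SimpleGraph.hasse (ℕ × ℕ)).induce (S : Set (ℕ × ℕ))).Connected ∧
  ¬ ∃ i j : ℕ, (i, j) ∈ S ∧ (i, j + 1) ∈ S ∧ (i + 1, j) ∈ S ∧ (i + 1, j + 1) ∈ S

/-- The height of a border strip: its number of rows minus one. -/
def stripHeight (S : Finset (ℕ × ℕ)) : ℕ := (S.image Prod.fst).card - 1

/-- The cells of `lam / mu` occupied by `i` in a filling. -/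
def occupied {lam mu : YoungDiagram} (entry : skewCells lam mu → ℕ+) (i : ℕ+) :
    Finset (ℕ × ℕ) :=
  (Finset.univ.filter (fun c => entry c = i)).map (Function.Embedding.subtype _)

/-- Border-strip tableaux of shape `lam / mu` and type `α`. The `i`-th part of `α` is taken to be
`0` for `i` larger than the length of `α`. -/
@[ext]
structure BorderStripTableau (lam mu : YoungDiagram) {n : ℕ} (α : Composition n) where
  entry : skewCells lam mu → ℕ+
  row_weak : ∀ c c' : skewCells lam mu, c.1.1 = c'.1.1 → c.1.2 ≤ c'.1.2 → entry c ≤ entry c'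
  col_weak : ∀ c c' : skewCells lam mu, c.1.2 = c'.1.2 → c.1.1 ≤ c'.1.1 → entry c ≤ entry c'
  card_occupied : ∀ i : ℕ+, (occupied entry i).card = α.blocks.getD ((i : ℕ) - 1) 0
  strip : ∀ i : ℕ+, (occupied entry i).Nonempty → IsBorderStrip (occupied entry i)

namespace BorderStripTableau

variable {lam mu : YoungDiagram} {n : ℕ} {α : Composition n}

/-- The height of a border-strip tableau: the sum of the heights of its border strips. -/
def height (T : BorderStripTableau lam mu α) : ℕ :=
  ∑ i ∈ Finset.univ.image T.entry, stripHeight (occupied T.entry i)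

theorem entry_le (T : BorderStripTableau lam mu α) (c : skewCells lam mu) :
    (T.entry c : ℕ) ≤ α.length := by
  by_contra h
  have h1 := T.card_occupied (T.entry c)
  have h2 : α.blocks.length ≤ (T.entry c : ℕ) - 1 := by
    have : α.blocks.length = α.length := rfl
    omega
  rw [List.getD_eq_default _ _ h2, Finset.card_eq_zero] at h1
  have h3 : c.1 ∈ occupied T.entry (T.entry c) := by simp [occupied]
  rw [h1] at h3
  simp at h3

instance : Finite (BorderStripTableau lam mu α) := by
  have h : ((fun T : BorderStripTableau lam mu α => T.entry) '' Set.univ).Finite := by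
    refine (finite_of_entries (Finset.Icc 1 α.length.succPNat)).subset ?_
    rintro _ ⟨T, _, rfl⟩ c
    refine Finset.mem_Icc.2 ⟨one_le, ?_⟩
    have h2 : (T.entry c : ℕ) ≤ α.length := T.entry_le c
    change (T.entry c : ℕ) ≤ α.length + 1
    omega
  exact Set.finite_univ_iff.1
    (h.of_finite_image (fun T _ T' _ e => BorderStripTableau.ext e))

noncomputable instance : Fintype (BorderStripTableau lam mu α) := Fintype.ofFinite _

end BorderStripTableau

/-- `χ^{lam / mu}(α) = ∑ T, (-1) ^ ht(T)`, over the border-strip tableaux `T` of shape `lam / mu`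
and type `α`. -/
noncomputable def chi (lam mu : YoungDiagram) {n : ℕ} (α : Composition n) : ℤ :=
  ∑ T : BorderStripTableau lam mu α, (-1) ^ T.height

end PsiMN

namespace PsiMN

/-! ### Border strips in terms of row lengths -/

/-! Fix a diagram `Lam` and let matrices act on the diagrams contained in it. Let `H_n` have entry 1
at `(mu, lam)` when `lam / mu` is a horizontal strip of size `n`, and let `B_n` have entry `(-1) ^
height` when `lam / mu` is a border strip of size `n`. All other entries are zero.

The core is the identity `n H_n = ∑_{k < n} H_k B_{n-k}` (`smul_stepMatrix_horizontalWeight`). Its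
right side counts, with sign, the diagrams `nu` for which `nu / mu` is a horizontal strip and `lam /
nu` a border strip. If `lam / mu` is not a horizontal strip, a sign-reversing involution that
changes a single row of `nu` cancels everything (`sum_isSplit_eq_zero`). If it is one, every such
border strip lies in one row, has sign +1 and is determined by its leftmost cell, so the count is
the number of cells (`sum_isSplit_eq_card`).

This is the recursion that defines the noncommutative power sums of the first kind from the complete
functions. Solving it gives `H_n = ∑_α π(α)⁻¹ B_α` over compositions `α` of `n`, with `B_α` the
ordered product of the `B_{α_i}` (`eq_sum_composition`). Multiplying these expansions along `β`
gives `H_β = ∑ π(α, β)⁻¹ B_α` over the refinements `α` of `β` (`prod_eq_sum_gather`).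

Finally, fillings are chains of diagrams, so entries of matrix products count tableaux
(`prod_stepMatrix_apply`). The `(mu, lam)` entry of `B_α` is `chi` (`chi_eq_borderProd`), and that
of `H_β` is the coefficient of `M_β` in the skew Schur function (`skewSchur_apply`,
`monomialQSym_apply`). Comparing coefficients proves the expansion. -/

theorem mem_skewCells {lam mu : YoungDiagram} {i j : ℕ} :
    (i, j) ∈ skewCells lam mu ↔ j < lam.rowLen i ∧ mu.rowLen i ≤ j := by
  simp only [skewCells, Finset.mem_sdiff, YoungDiagram.mem_cells,
    YoungDiagram.mem_iff_lt_rowLen, not_lt]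

theorem le_iff_rowLen_le {mu lam : YoungDiagram} :
    mu ≤ lam ↔ ∀ i, mu.rowLen i ≤ lam.rowLen i := by
  constructor
  · intro h i
    by_contra hlt
    have h1 : (i, lam.rowLen i) ∈ mu := YoungDiagram.mem_iff_lt_rowLen.2 (not_le.1 hlt)
    exact lt_irrefl _ (YoungDiagram.mem_iff_lt_rowLen.1 (h h1))
  · rintro h ⟨i, j⟩ hc
    exact YoungDiagram.mem_iff_lt_rowLen.2 ((YoungDiagram.mem_iff_lt_rowLen.1 hc).trans_le (h i))

theorem eq_of_rowLen_eq {mu lam : YoungDiagram} (h : ∀ i, mu.rowLen i = lam.rowLen i) :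
    mu = lam :=
  le_antisymm (le_iff_rowLen_le.2 fun i => (h i).le) (le_iff_rowLen_le.2 fun i => (h i).ge)

/-- The Young diagram with row lengths `g i`, for an antitone `g` bounded by the row lengths
of `lam`. -/
def rowDiagram (lam : YoungDiagram) (g : ℕ → ℕ) (hg : Antitone g) : YoungDiagram where
  cells := lam.cells.filter (fun c => c.2 < g c.1)
  isLowerSet := by
    rintro ⟨i, j⟩ ⟨i', j'⟩ ⟨hi, hj⟩ h
    simp only [Finset.coe_filter, Set.mem_ofPred_eq, YoungDiagram.mem_cells] at h ⊢
    exact ⟨lam.up_left_mem hi hj h.1, (hj.trans_lt h.2).trans_le (hg hi)⟩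

theorem rowLen_rowDiagram {lam : YoungDiagram} {g : ℕ → ℕ} (hg : Antitone g)
    (h : ∀ i, g i ≤ lam.rowLen i) (i : ℕ) : (rowDiagram lam g hg).rowLen i = g i := by
  have key : ∀ j, j < (rowDiagram lam g hg).rowLen i ↔ j < g i := by
    intro j
    rw [← YoungDiagram.mem_iff_lt_rowLen, ← YoungDiagram.mem_cells]
    simp only [rowDiagram, Finset.mem_filter, YoungDiagram.mem_cells,
      YoungDiagram.mem_iff_lt_rowLen]
    exact ⟨fun h => h.2, fun hj => ⟨hj.trans_le (h i), hj⟩⟩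
  exact le_antisymm (not_lt.1 fun hlt => lt_irrefl _ ((key _).1 hlt))
    (not_lt.1 fun hlt => lt_irrefl _ ((key _).2 hlt))

/-- The skew shape `lam / nu` is a rim hook occupying the rows `r, ..., s`. -/
structure IsRimHook (lam nu : YoungDiagram) (r s : ℕ) : Prop where
  le : r ≤ s
  above : ∀ i < r, nu.rowLen i = lam.rowLen i
  below : ∀ i, s < i → nu.rowLen i = lam.rowLen i
  mid : ∀ i, r ≤ i → i < s → nu.rowLen i + 1 = lam.rowLen (i + 1)
  last : nu.rowLen s < lam.rowLen s

theorem IsRimHook.rowLen_lt_iff {lam nu : YoungDiagram} {r s : ℕ} (h : IsRimHook lam nu r s)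
    (i : ℕ) : nu.rowLen i < lam.rowLen i ↔ r ≤ i ∧ i ≤ s := by
  constructor
  · intro hi
    constructor
    · by_contra hr
      exact hi.ne (h.above i (not_le.1 hr))
    · by_contra hs
      exact hi.ne (h.below i (not_le.1 hs))
  · rintro ⟨hr, hs⟩
    rcases hs.lt_or_eq with hs | rfl
    · have h1 := h.mid i hr hs
      have h2 := lam.rowLen_anti i (i + 1) (by omega)
      omega
    · exact h.last

theorem mem_image_fst_skewCells {lam nu : YoungDiagram} {i : ℕ} :
    i ∈ (skewCells lam nu).image Prod.fst ↔ nu.rowLen i < lam.rowLen i := by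
  constructor
  · intro h
    obtain ⟨⟨a, b⟩, hc, rfl⟩ := Finset.mem_image.1 h
    have := mem_skewCells.1 hc
    exact this.2.trans_lt this.1
  · intro h
    exact Finset.mem_image.2 ⟨(i, nu.rowLen i), mem_skewCells.2 ⟨h, le_rfl⟩, rfl⟩

theorem IsRimHook.stripHeight_eq {lam nu : YoungDiagram} {r s : ℕ} (h : IsRimHook lam nu r s) :
    stripHeight (skewCells lam nu) = s - r := by
  have h1 : (skewCells lam nu).image Prod.fst = Finset.Icc r s := by
    ext i
    rw [mem_image_fst_skewCells, h.rowLen_lt_iff, Finset.mem_Icc]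
  have := h.le
  rw [stripHeight, h1, Nat.card_Icc]
  omega

theorem hasse_adj_iff {a b c d : ℕ} : (SimpleGraph.hasse (ℕ × ℕ)).Adj (a, b) (c, d) ↔
    (a + 1 = c ∧ b = d ∨ b + 1 = d ∧ a = c) ∨ (c + 1 = a ∧ d = b ∨ d + 1 = b ∧ c = a) := by
  simp only [SimpleGraph.hasse_adj, Prod.mk_covBy_mk_iff, Nat.covBy_iff_add_one_eq]

theorem iff_of_reachable {V : Type*} {G : SimpleGraph V} {P : V → Prop}
    (h : ∀ a b, G.Adj a b → P a → P b) {a b : V} (hab : G.Reachable a b) (ha : P a) : P b := by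
  obtain ⟨p⟩ := hab
  induction p with
  | nil => exact ha
  | cons hadj _ ih => exact ih (h _ _ hadj ha)

/-- Rows `i` and `i + 1` share the columns from `nu.rowLen i` up to, but excluding, `lam.rowLen (i +
1)`. Connectedness forces at least one shared column, and the absence of a `2 × 2` square allows at
most one; this is the equation `mid`. -/
theorem IsBorderStrip.exists_isRimHook {lam nu : YoungDiagram} (hle : nu ≤ lam)
    (h : IsBorderStrip (skewCells lam nu)) : ∃ r s, IsRimHook lam nu r s := by
  obtain ⟨-, hconn, hsq⟩ := h
  have hle' := le_iff_rowLen_le.1 hle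
  obtain ⟨⟨c, hc⟩⟩ := hconn.nonempty
  set R := (skewCells lam nu).image Prod.fst with hR
  have hRne : R.Nonempty := ⟨c.1, Finset.mem_image_of_mem _ hc⟩
  have hr := mem_image_fst_skewCells.1 (R.min'_mem hRne)
  have hs := mem_image_fst_skewCells.1 (R.max'_mem hRne)
  set r := R.min' hRne
  set s := R.max' hRne
  have hmin : ∀ i, nu.rowLen i < lam.rowLen i → r ≤ i := fun i hi =>
    R.min'_le i (mem_image_fst_skewCells.2 hi)
  have hmax : ∀ i, nu.rowLen i < lam.rowLen i → i ≤ s := fun i hi =>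
    R.le_max' i (mem_image_fst_skewCells.2 hi)
  refine ⟨r, s, hmin s hs, ?_, ?_, ?_, hs⟩
  · intro i hi
    have := hle' i
    by_contra hne
    have := hmin i (by omega)
    omega
  · intro i hi
    have := hle' i
    by_contra hne
    have := hmax i (by omega)
    omega
  · intro i hri his
    -- Without a shared column no edge leaves the rows up to `i`, so the top row `r` could not be
    -- joined to the bottom row `s`.
    have h1 : nu.rowLen i < lam.rowLen (i + 1) := by
      by_contra hlt
      have hreach := hconn.preconnected
        ⟨(r, nu.rowLen r), Finset.mem_coe.2 (mem_skewCells.2 ⟨hr, le_rfl⟩)⟩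
        ⟨(s, nu.rowLen s), Finset.mem_coe.2 (mem_skewCells.2 ⟨hs, le_rfl⟩)⟩
      have := iff_of_reachable (P := fun c => c.1.1 ≤ i) ?_ hreach hri
      · exact absurd this (not_le.2 his)
      · rintro ⟨⟨a, b⟩, hab⟩ ⟨⟨a', b'⟩, hab'⟩ hadj ha
        have hadj' : (SimpleGraph.hasse (ℕ × ℕ)).Adj (a, b) (a', b') := hadj
        rw [hasse_adj_iff] at hadj'
        have hab1 := mem_skewCells.1 (Finset.mem_coe.1 hab)
        have hab2 := mem_skewCells.1 (Finset.mem_coe.1 hab')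
        simp only at ha ⊢
        by_contra hcon
        obtain rfl : a = i := by omega
        obtain rfl : a' = a + 1 := by omega
        omega
    by_contra hne
    refine hsq ⟨i, nu.rowLen i, ?_⟩
    have h2 := lam.rowLen_anti i (i + 1) (by omega)
    have h3 := nu.rowLen_anti i (i + 1) (by omega)
    simp only [mem_skewCells]
    omega

theorem IsRimHook.isBorderStrip {lam nu : YoungDiagram} {r s : ℕ} (hle : nu ≤ lam)
    (h : IsRimHook lam nu r s) : IsBorderStrip (skewCells lam nu) := by
  have hlt : ∀ i, r ≤ i → i ≤ s → nu.rowLen i < lam.rowLen i := fun i hr hs =>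
    (h.rowLen_lt_iff i).2 ⟨hr, hs⟩
  refine ⟨⟨lam, nu, hle, rfl⟩, ?_, ?_⟩
  · rw [SimpleGraph.connected_iff_exists_forall_reachable]
    have hbase : ∀ i, r ≤ i → i ≤ s → (i, nu.rowLen i) ∈ (skewCells lam nu : Set (ℕ × ℕ)) :=
      fun i hr hs => Finset.mem_coe.2 (mem_skewCells.2 ⟨hlt i hr hs, le_rfl⟩)
    set G := (SimpleGraph.hasse (ℕ × ℕ)).induce (skewCells lam nu : Set (ℕ × ℕ)) with hG
    have hrow : ∀ k i (hc : (i, nu.rowLen i + k) ∈ (skewCells lam nu : Set (ℕ × ℕ)))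
        (hb : (i, nu.rowLen i) ∈ (skewCells lam nu : Set (ℕ × ℕ))),
        G.Reachable ⟨_, hb⟩ ⟨_, hc⟩ := by
      intro k
      induction k with
      | zero => intro i hc hb; rfl
      | succ k ih =>
        intro i hc hb
        have h1 := mem_skewCells.1 (Finset.mem_coe.1 hc)
        have hc' : (i, nu.rowLen i + k) ∈ (skewCells lam nu : Set (ℕ × ℕ)) :=
          Finset.mem_coe.2 (mem_skewCells.2 (by omega))
        refine (ih i hc' hb).trans (SimpleGraph.Adj.reachable ?_)
        change (SimpleGraph.hasse (ℕ × ℕ)).Adj (i, nu.rowLen i + k) (i, nu.rowLen i + (k + 1))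
        rw [hasse_adj_iff]
        omega
    -- The path follows the leftmost cells: by `mid` the cell below the leftmost cell of a row is
    -- still in the strip, and from there `hrow` leads left to the start of the next row.
    have hdown : ∀ k (hk : r + k ≤ s), G.Reachable ⟨_, hbase r le_rfl h.le⟩
        ⟨_, hbase (r + k) (by omega) hk⟩ := by
      intro k
      induction k with
      | zero => intro hk; rfl
      | succ k ih =>
        intro hk
        refine (ih (by omega)).trans ?_
        have hm := h.mid (r + k) (by omega) (by omega)
        have hanti := nu.rowLen_anti (r + k) (r + k + 1) (by omega)
        have hl := hlt (r + k + 1) (by omega) hk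
        have hc : (r + k + 1, nu.rowLen (r + k)) ∈ (skewCells lam nu : Set (ℕ × ℕ)) :=
          Finset.mem_coe.2 (mem_skewCells.2 ⟨by omega, hanti⟩)
        have hadj : G.Adj ⟨_, hbase (r + k) (by omega) (by omega)⟩ ⟨_, hc⟩ := by
          change (SimpleGraph.hasse (ℕ × ℕ)).Adj (r + k, nu.rowLen (r + k))
            (r + k + 1, nu.rowLen (r + k))
          rw [hasse_adj_iff]
          omega
        refine hadj.reachable.trans (SimpleGraph.Reachable.symm ?_)
        obtain ⟨m, hm'⟩ := Nat.exists_eq_add_of_le hanti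
        have := hrow m (r + k + 1) (by rw [← hm']; exact hc)
          (hbase (r + k + 1) (by omega) hk)
        convert this using 3 <;> rfl
    refine ⟨⟨_, hbase r le_rfl h.le⟩, ?_⟩
    rintro ⟨⟨i, j⟩, hc⟩
    have h1 := mem_skewCells.1 (Finset.mem_coe.1 hc)
    have h2 := (h.rowLen_lt_iff i).1 (by omega)
    obtain ⟨m, rfl⟩ := Nat.exists_eq_add_of_le h1.2
    obtain ⟨k, rfl⟩ := Nat.exists_eq_add_of_le h2.1
    exact (hdown k h2.2).trans (hrow m _ hc _)
  · rintro ⟨i, j, h1, h2, h3, h4⟩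
    rw [mem_skewCells] at h1 h2 h3 h4
    have hi := (h.rowLen_lt_iff i).1 (by omega)
    have hi' := (h.rowLen_lt_iff (i + 1)).1 (by omega)
    have := h.mid i hi.1 (by omega)
    omega

/-! ### Horizontal strips and the recursion `n H_n = ∑ H_k B_{n - k}` -/

/-- A set of cells with at most one cell in each column. -/
def IsHorizontalStrip (S : Finset (ℕ × ℕ)) : Prop :=
  ∀ c ∈ S, ∀ c' ∈ S, c.2 = c'.2 → c = c'

theorem isHorizontalStrip_skewCells_iff {lam mu : YoungDiagram} :
    IsHorizontalStrip (skewCells lam mu) ↔ ∀ i, lam.rowLen (i + 1) ≤ mu.rowLen i := by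
  constructor
  · intro h i
    by_contra hlt
    have h1 := lam.rowLen_anti i (i + 1) (by omega)
    have h2 := mu.rowLen_anti i (i + 1) (by omega)
    have := h (i, mu.rowLen i) (mem_skewCells.2 (by omega)) (i + 1, mu.rowLen i)
      (mem_skewCells.2 (by omega)) rfl
    simp at this
  · have key : (∀ i, lam.rowLen (i + 1) ≤ mu.rowLen i) → ∀ i i' j, (i, j) ∈ skewCells lam mu →
        (i', j) ∈ skewCells lam mu → ¬ i < i' := by
      intro h i i' j hc hc' hlt
      rw [mem_skewCells] at hc hc'
      have h1 := lam.rowLen_anti (i + 1) i' hlt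
      have h2 := h i
      omega
    rintro h ⟨i, j⟩ hc ⟨i', j'⟩ hc' (rfl : j = j')
    have h1 := key h i i' j hc hc'
    have h2 := key h i' i j hc' hc
    exact Prod.ext (by simp only; omega) rfl

theorem card_skewCells_add {lam nu mu : YoungDiagram} (h1 : mu ≤ nu) (h2 : nu ≤ lam) :
    (skewCells nu mu).card + (skewCells lam nu).card = (skewCells lam mu).card := by
  rw [← YoungDiagram.cells_subset_iff] at h1 h2
  rw [skewCells, skewCells, skewCells, Finset.card_sdiff_of_subset h1,
    Finset.card_sdiff_of_subset h2, Finset.card_sdiff_of_subset (h1.trans h2)]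
  have := Finset.card_le_card h1
  have := Finset.card_le_card h2
  omega

instance finite_Iic (Lam : YoungDiagram) : Finite (Set.Iic Lam) := by
  have h : (YoungDiagram.cells '' Set.Iic Lam).Finite := by
    refine (Lam.cells.powerset.finite_toSet).subset ?_
    rintro _ ⟨nu, hnu, rfl⟩
    exact Finset.mem_coe.2 (Finset.mem_powerset.2 (YoungDiagram.cells_subset_iff.2 hnu))
  exact (h.of_finite_image fun _ _ _ _ e => YoungDiagram.ext e).to_subtype

noncomputable instance (Lam : YoungDiagram) : Fintype (Set.Iic Lam) := Fintype.ofFinite _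

noncomputable instance (Lam : YoungDiagram) : DecidableEq (Set.Iic Lam) := Classical.decEq _

/-- `nu / mu` is a horizontal strip and `lam / nu` is a border strip. -/
structure IsSplit (lam mu nu : YoungDiagram) : Prop where
  le_left : mu ≤ nu
  le_right : nu ≤ lam
  horizontal : IsHorizontalStrip (skewCells nu mu)
  border : IsBorderStrip (skewCells lam nu)

/-- Row `a` is the first place where `lam / mu` fails to be a horizontal strip. The border strip
must meet row `a + 1`, since `nu / mu` is horizontal, and cannot start above row `a`, by minimality.
So its top row is `a + 1` or `a`, and row `a` of `nu` has length `lam.rowLen a` or `lam.rowLen (a +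
1) - 1` accordingly. Exchanging these two lengths keeps a valid split and changes the height by one.
-/
theorem IsSplit.exists_toggle {lam mu nu : YoungDiagram} (h : IsSplit lam mu nu) {a : ℕ}
    (ha : mu.rowLen a < lam.rowLen (a + 1)) (hmin : ∀ i < a, lam.rowLen (i + 1) ≤ mu.rowLen i) :
    ∃ nu', IsSplit lam mu nu' ∧ (∀ i, i ≠ a → nu'.rowLen i = nu.rowLen i) ∧
      (nu.rowLen a = lam.rowLen a ∧ nu'.rowLen a + 1 = lam.rowLen (a + 1) ∨
        nu.rowLen a + 1 = lam.rowLen (a + 1) ∧ nu'.rowLen a = lam.rowLen a) ∧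
      (-1 : ℂ) ^ stripHeight (skewCells lam nu) + (-1) ^ stripHeight (skewCells lam nu') = 0 := by
  obtain ⟨r, s, hrs⟩ := h.border.exists_isRimHook h.le_right
  have hmn := le_iff_rowLen_le.1 h.le_left
  have hnl := le_iff_rowLen_le.1 h.le_right
  have hh := isHorizontalStrip_skewCells_iff.1 h.horizontal
  have hla := lam.rowLen_anti
  have hr : r ≤ a + 1 ∧ a + 1 ≤ s := (hrs.rowLen_lt_iff (a + 1)).1 ((hh a).trans_lt ha)
  -- Otherwise `nu.rowLen r + 1 = lam.rowLen (r + 1) ≤ mu.rowLen r ≤ nu.rowLen r`.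
  have hra : ¬ r < a := by
    intro hlt
    have h1 := hrs.mid r le_rfl (by omega)
    have h2 := hmin r hlt
    have h3 := hmn r
    omega
  have hupper : ∀ i < a, nu.rowLen i = lam.rowLen i := fun i hi => hrs.above i (by omega)
  -- the new length of row `a`, and the new top row of the strip
  obtain ⟨x, r', hx⟩ : ∃ x r', (nu.rowLen a = lam.rowLen a ∧ x + 1 = lam.rowLen (a + 1) ∧
      r = a + 1 ∧ r' = a) ∨ (nu.rowLen a + 1 = lam.rowLen (a + 1) ∧ x = lam.rowLen a ∧
      r = a ∧ r' = a + 1) := by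
    rcases (show r = a + 1 ∨ r = a by omega) with e | e
    · exact ⟨lam.rowLen (a + 1) - 1, a, Or.inl ⟨hrs.above a (by omega), by omega, e, rfl⟩⟩
    · exact ⟨lam.rowLen a, a + 1, Or.inr ⟨hrs.mid a (by omega) (by omega), rfl, e, rfl⟩⟩
  have hla' := hla a (a + 1) (by omega)
  have hxa : x ≤ lam.rowLen a ∧ mu.rowLen a ≤ x := by omega
  set g : ℕ → ℕ := fun i => if i = a then x else nu.rowLen i with hg
  have hga : g a = x := by simp [hg]
  have hgi : ∀ i, i ≠ a → g i = nu.rowLen i := fun i hi => by simp [hg, hi]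
  have hanti : Antitone g := by
    refine antitone_nat_of_succ_le fun i => ?_
    rcases eq_or_ne i a with rfl | hi
    · rw [hga, hgi _ (by omega)]
      have := hh i
      omega
    · rw [hgi i hi]
      rcases eq_or_ne (i + 1) a with rfl | hi'
      · rw [hga, hupper i (by omega)]
        have := hla i (i + 1) (by omega)
        omega
      · rw [hgi _ hi']
        exact nu.rowLen_anti _ _ (by omega)
  have hgl : ∀ i, g i ≤ lam.rowLen i := by
    intro i
    rcases eq_or_ne i a with rfl | hi
    · rw [hga]; exact hxa.1
    · rw [hgi i hi]; exact hnl i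
  have hrow := rowLen_rowDiagram hanti hgl
  set nu' := rowDiagram lam g hanti
  have hrowa : nu'.rowLen a = x := (hrow a).trans hga
  have hrowi : ∀ i, i ≠ a → nu'.rowLen i = nu.rowLen i := fun i hi => (hrow i).trans (hgi i hi)
  have hle : nu' ≤ lam := le_iff_rowLen_le.2 fun i => (hrow i).trans_le (hgl i)
  have hrim : IsRimHook lam nu' r' s := by
    refine ⟨by omega, ?_, ?_, ?_, ?_⟩
    · intro i hi
      rcases eq_or_ne i a with rfl | hia
      · omega
      · rw [hrowi i hia]; exact hupper i (by omega)
    · intro i hi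
      rw [hrowi i (by omega)]
      exact hrs.below i hi
    · intro i hi hi'
      rcases eq_or_ne i a with rfl | hia
      · omega
      · rw [hrowi i hia]; exact hrs.mid i (by omega) hi'
    · rw [hrowi s (by omega)]; exact hrs.last
  refine ⟨nu', ⟨?_, hle, ?_, hrim.isBorderStrip hle⟩, hrowi, by omega, ?_⟩
  · refine le_iff_rowLen_le.2 fun i => ?_
    rcases eq_or_ne i a with rfl | hia
    · omega
    · rw [hrowi i hia]; exact hmn i
  · refine isHorizontalStrip_skewCells_iff.2 fun i => ?_
    rcases eq_or_ne (i + 1) a with rfl | hia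
    -- Only this row can be affected by a longer row `a`; there the new length is at most
    -- `lam.rowLen a`, which minimality of `a` bounds by the row of `mu` above.
    · have := hmin i (by omega)
      omega
    · rw [hrowi _ hia]; exact hh i
  · rw [hrs.stripHeight_eq, hrim.stripHeight_eq]
    have hss : s - a = s - (a + 1) + 1 := by omega
    rcases hx with ⟨-, -, rfl, rfl⟩ | ⟨-, -, rfl, rfl⟩ <;> rw [hss, pow_succ] <;> ring

open Classical in
theorem sum_isSplit_eq_zero {Lam lam mu : YoungDiagram} (hL : lam ≤ Lam)
    (h : ¬ IsHorizontalStrip (skewCells lam mu)) :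
    ∑ nu : Set.Iic Lam with IsSplit lam mu nu.1,
      (-1 : ℂ) ^ stripHeight (skewCells lam nu.1) = 0 := by
  have hex : ∃ a, mu.rowLen a < lam.rowLen (a + 1) := by
    by_contra hcon
    exact h (isHorizontalStrip_skewCells_iff.2 fun i => not_lt.1 fun hi => hcon ⟨i, hi⟩)
  -- The row `a` depends on `lam` and `mu` but not on `nu`, so the toggle acts on the same row both
  -- times and is an involution. It has no fixed point because `lam.rowLen (a + 1) - 1 < lam.rowLen
  -- a`.
  set a := Nat.find hex with hadef
  have ha : mu.rowLen a < lam.rowLen (a + 1) := Nat.find_spec hex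
  have hmin : ∀ i < a, lam.rowLen (i + 1) ≤ mu.rowLen i := fun i hi =>
    not_lt.1 (Nat.find_min hex hi)
  have hla := lam.rowLen_anti a (a + 1) (by omega)
  have htog : ∀ nu : Set.Iic Lam, IsSplit lam mu nu.1 → ∃ nu' : Set.Iic Lam,
      IsSplit lam mu nu'.1 ∧ (∀ i, i ≠ a → nu'.1.rowLen i = nu.1.rowLen i) ∧
      (nu.1.rowLen a = lam.rowLen a ∧ nu'.1.rowLen a + 1 = lam.rowLen (a + 1) ∨
        nu.1.rowLen a + 1 = lam.rowLen (a + 1) ∧ nu'.1.rowLen a = lam.rowLen a) ∧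
      (-1 : ℂ) ^ stripHeight (skewCells lam nu.1) +
        (-1) ^ stripHeight (skewCells lam nu'.1) = 0 := by
    intro nu hnu
    obtain ⟨nu', h1, h2⟩ := hnu.exists_toggle ha hmin
    exact ⟨⟨nu', h1.le_right.trans hL⟩, h1, h2⟩
  choose! t ht using htog
  have hmem : ∀ nu : Set.Iic Lam, nu ∈ Finset.univ.filter
      (fun nu : Set.Iic Lam => IsSplit lam mu nu.1) ↔ IsSplit lam mu nu.1 := by simp
  refine Finset.sum_involution (fun nu _ => t nu) ?_ ?_ ?_ ?_
  · exact fun nu hnu => (ht nu ((hmem nu).1 hnu)).2.2.2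
  · intro nu hnu _ he
    have := (ht nu ((hmem nu).1 hnu)).2.2.1
    rw [he] at this
    omega
  · exact fun nu hnu => (hmem _).2 (ht nu ((hmem nu).1 hnu)).1
  · intro nu hnu
    have h1 := ht nu ((hmem nu).1 hnu)
    have h2 := ht (t nu) h1.1
    refine Subtype.ext (eq_of_rowLen_eq fun i => ?_)
    rcases eq_or_ne i a with rfl | hi
    · have := h1.2.2.1
      have := h2.2.2.1
      omega
    · rw [h2.2.1 i hi, h1.2.1 i hi]

/-- A border strip with two rows would have `lam.rowLen (r + 1) = nu.rowLen r + 1 > mu.rowLen r`,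
against horizontality of `lam / mu`. -/
theorem IsSplit.isRimHook_self {lam mu nu : YoungDiagram} (h : IsSplit lam mu nu)
    (hh : IsHorizontalStrip (skewCells lam mu)) : ∃ s, IsRimHook lam nu s s := by
  obtain ⟨r, s, hrs⟩ := h.border.exists_isRimHook h.le_right
  rcases hrs.le.lt_or_eq with hlt | rfl
  · have h1 := hrs.mid r le_rfl hlt
    have h2 := isHorizontalStrip_skewCells_iff.1 hh r
    have h3 := le_iff_rowLen_le.1 h.le_left r
    omega
  · exact ⟨r, hrs⟩

/-- The diagram `nu` is `lam` with row `i` cut off from column `j` on. It remains a diagram because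
row `i + 1` of `lam` is no longer than row `i` of `mu`. -/
theorem exists_isSplit_of_mem {lam mu : YoungDiagram} (hmu : mu ≤ lam)
    (hh : IsHorizontalStrip (skewCells lam mu)) {i j : ℕ} (hc : (i, j) ∈ skewCells lam mu) :
    ∃ nu, IsSplit lam mu nu ∧ nu.rowLen i = j ∧ ∀ k, k ≠ i → nu.rowLen k = lam.rowLen k := by
  rw [mem_skewCells] at hc
  have hh' := isHorizontalStrip_skewCells_iff.1 hh
  have hml := le_iff_rowLen_le.1 hmu
  set g : ℕ → ℕ := fun k => if k = i then j else lam.rowLen k with hg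
  have hgi : g i = j := by simp [hg]
  have hgk : ∀ k, k ≠ i → g k = lam.rowLen k := fun k hk => by simp [hg, hk]
  have hgl : ∀ k, g k ≤ lam.rowLen k := by
    intro k
    rcases eq_or_ne k i with rfl | hk
    · omega
    · exact (hgk k hk).le
  have hanti : Antitone g := by
    refine antitone_nat_of_succ_le fun k => ?_
    rcases eq_or_ne k i with rfl | hk
    · have h1 := hgl (k + 1)
      have h2 := hh' k
      omega
    · rw [hgk k hk]
      exact (hgl (k + 1)).trans (lam.rowLen_anti _ _ (by omega))
  have hrow := rowLen_rowDiagram hanti hgl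
  set nu := rowDiagram lam g hanti
  have hle : nu ≤ lam := le_iff_rowLen_le.2 fun k => (hrow k).trans_le (hgl k)
  refine ⟨nu, ⟨?_, hle, ?_, ?_⟩, (hrow i).trans hgi, fun k hk => (hrow k).trans (hgk k hk)⟩
  · refine le_iff_rowLen_le.2 fun k => ?_
    rw [hrow]
    rcases eq_or_ne k i with rfl | hk
    · omega
    · rw [hgk k hk]; exact hml k
  · refine isHorizontalStrip_skewCells_iff.2 fun k => ?_
    rw [hrow]
    exact (hgl _).trans (hh' k)
  · refine IsRimHook.isBorderStrip (r := i) (s := i) hle ⟨le_rfl, ?_, ?_, ?_, ?_⟩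
    · intro k hk
      rw [hrow, hgk k (by omega)]
    · intro k hk
      rw [hrow, hgk k (by omega)]
    · intro k hk hk'
      omega
    · rw [hrow, hgi]; exact hc.1

open Classical in
theorem sum_isSplit_eq_card {Lam lam mu : YoungDiagram} (hL : lam ≤ Lam) (hmu : mu ≤ lam)
    (hh : IsHorizontalStrip (skewCells lam mu)) :
    ∑ nu : Set.Iic Lam with IsSplit lam mu nu.1,
      (-1 : ℂ) ^ stripHeight (skewCells lam nu.1) = (skewCells lam mu).card := by
  have hone : ∀ nu ∈ Finset.univ.filter (fun nu : Set.Iic Lam => IsSplit lam mu nu.1),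
      (-1 : ℂ) ^ stripHeight (skewCells lam nu.1) = 1 := by
    intro nu hnu
    obtain ⟨s, hs⟩ := (Finset.mem_filter.1 hnu).2.isRimHook_self hh
    rw [hs.stripHeight_eq, Nat.sub_self, pow_zero]
  rw [Finset.sum_congr rfl hone, Finset.sum_const, nsmul_eq_mul, mul_one]
  have hex : ∀ c : ℕ × ℕ, c ∈ skewCells lam mu → ∃ nu : Set.Iic Lam, IsSplit lam mu nu.1 ∧
      nu.1.rowLen c.1 = c.2 ∧ ∀ k, k ≠ c.1 → nu.1.rowLen k = lam.rowLen k := by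
    rintro ⟨i, j⟩ hc
    obtain ⟨nu, h1, h2⟩ := exists_isSplit_of_mem hmu hh hc
    exact ⟨⟨nu, h1.le_right.trans hL⟩, h1, h2⟩
  choose! t ht using hex
  congr 1
  symm
  refine Finset.card_bij (fun c _ => t c) ?_ ?_ ?_
  · exact fun c hc => Finset.mem_filter.2 ⟨Finset.mem_univ _, (ht c hc).1⟩
  · rintro ⟨i, j⟩ hc ⟨i', j'⟩ hc' he
    have h1 := (ht _ hc).2
    have h2 := (ht _ hc').2
    simp only at he h1 h2
    rw [← he] at h2
    rw [mem_skewCells] at hc hc'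
    have hii : i = i' := by
      by_contra hne
      have := h2.2 i hne
      omega
    subst hii
    exact Prod.ext rfl (h1.1.symm.trans h2.1)
  · intro nu hnu
    have hs := (Finset.mem_filter.1 hnu).2
    obtain ⟨s, hrim⟩ := hs.isRimHook_self hh
    have hc : (s, nu.1.rowLen s) ∈ skewCells lam mu :=
      mem_skewCells.2 ⟨hrim.last, le_iff_rowLen_le.1 hs.le_left s⟩
    refine ⟨_, hc, Subtype.ext (eq_of_rowLen_eq fun i => ?_)⟩
    have h1 := (ht _ hc).2
    rcases lt_trichotomy i s with hi | rfl | hi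
    · rw [h1.2 i hi.ne, hrim.above i hi]
    · exact h1.1
    · rw [h1.2 i hi.ne', hrim.below i hi]

/-! ### Transfer matrices of horizontal and border strips -/

/-- The matrix, indexed by the Young diagrams contained in `Lam`, whose entry at `(nu, kap)` is
the weight of the skew shape `kap / nu`. -/
noncomputable def stepMatrix (Lam : YoungDiagram) (w : Finset (ℕ × ℕ) → ℂ) :
    Matrix (Set.Iic Lam) (Set.Iic Lam) ℂ :=
  open Classical in
  Matrix.of fun nu kap => if nu.1 ≤ kap.1 then w (skewCells kap.1 nu.1) else 0

open Classical in
/-- The indicator function of horizontal strips of size `k`. -/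
noncomputable def horizontalWeight (k : ℕ) (S : Finset (ℕ × ℕ)) : ℂ :=
  if IsHorizontalStrip S ∧ S.card = k then 1 else 0

open Classical in
/-- The signed indicator function of border strips of size `k`. -/
noncomputable def borderWeight (k : ℕ) (S : Finset (ℕ × ℕ)) : ℂ :=
  if IsBorderStrip S ∧ S.card = k then (-1) ^ stripHeight S else 0

theorem IsBorderStrip.card_pos {S : Finset (ℕ × ℕ)} (h : IsBorderStrip S) : 0 < S.card := by
  obtain ⟨⟨c, hc⟩⟩ := h.2.1.nonempty
  exact Finset.card_pos.2 ⟨c, hc⟩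

theorem stepMatrix_horizontalWeight_zero (Lam : YoungDiagram) :
    stepMatrix Lam (horizontalWeight 0) = 1 := by
  classical
  ext nu kap
  rw [Matrix.one_apply, stepMatrix, Matrix.of_apply, horizontalWeight]
  rcases eq_or_ne nu kap with rfl | hne
  · simp [skewCells, IsHorizontalStrip]
  · rw [if_neg hne]
    split_ifs with h1 h2
    · refine absurd (Subtype.ext (le_antisymm h1 ?_)) hne
      rw [← YoungDiagram.cells_subset_iff, ← Finset.sdiff_eq_empty_iff_subset]
      exact Finset.card_eq_zero.1 h2.2
    · rfl
    · rfl

/-- In each entry, `nu` determines `k` as the size of the horizontal strip. Since border strips are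
nonempty, `k < n` holds automatically, so summing over `k` leaves the signed count of splits
evaluated before. -/
theorem smul_stepMatrix_horizontalWeight (Lam : YoungDiagram) (n : ℕ) :
    (n : ℂ) • stepMatrix Lam (horizontalWeight n) = ∑ k : Fin n,
      stepMatrix Lam (horizontalWeight k) * stepMatrix Lam (borderWeight (n - k)) := by
  classical
  ext mu kap
  rw [Matrix.smul_apply, Matrix.sum_apply]
  simp only [Matrix.mul_apply]
  rw [Finset.sum_comm]
  simp only [stepMatrix, Matrix.of_apply]
  have hterm : ∀ nu : Set.Iic Lam, ∑ k : Fin n,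
      (if mu.1 ≤ nu.1 then horizontalWeight k (skewCells nu.1 mu.1) else 0) *
        (if nu.1 ≤ kap.1 then borderWeight (n - k) (skewCells kap.1 nu.1) else 0) =
      if IsSplit kap.1 mu.1 nu.1 then
        (if (skewCells kap.1 mu.1).card = n then
          (-1 : ℂ) ^ stripHeight (skewCells kap.1 nu.1) else 0) else 0 := by
    intro nu
    by_cases h1 : IsSplit kap.1 mu.1 nu.1
    · have hcard := card_skewCells_add h1.le_left h1.le_right
      have hpos := h1.border.card_pos
      rw [if_pos h1]
      simp only [if_pos h1.le_left, if_pos h1.le_right]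
      by_cases h2 : (skewCells kap.1 mu.1).card = n
      · rw [if_pos h2, Finset.sum_eq_single_of_mem
          (⟨(skewCells nu.1 mu.1).card, by omega⟩ : Fin n) (Finset.mem_univ _)]
        · rw [horizontalWeight, if_pos ⟨h1.horizontal, rfl⟩, borderWeight,
            if_pos ⟨h1.border, by simp only; omega⟩, one_mul]
        · intro k _ hk
          rw [horizontalWeight, if_neg, zero_mul]
          rintro ⟨-, he⟩
          exact hk (Fin.ext he.symm)
      · rw [if_neg h2]
        refine Finset.sum_eq_zero fun k _ => ?_
        rw [horizontalWeight, borderWeight]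
        split_ifs with h3 h4
        · have := k.2
          omega
        all_goals simp
    · rw [if_neg h1]
      refine Finset.sum_eq_zero fun k _ => ?_
      by_contra hne
      refine h1 ⟨?_, ?_, ?_, ?_⟩
      all_goals
        by_contra hcon
        apply hne
        simp [horizontalWeight, borderWeight, hcon]
  rw [Finset.sum_congr rfl fun nu _ => hterm nu, ← Finset.sum_filter]
  by_cases hn : (skewCells kap.1 mu.1).card = n
  · simp only [if_pos hn]
    by_cases hh : IsHorizontalStrip (skewCells kap.1 mu.1)
    · by_cases hle : mu.1 ≤ kap.1
      · rw [sum_isSplit_eq_card kap.2 hle hh, if_pos hle, horizontalWeight, if_pos ⟨hh, hn⟩, hn]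
        simp
      · rw [if_neg hle, smul_zero, Finset.filter_false_of_mem, Finset.sum_empty]
        exact fun nu _ h => hle (h.le_left.trans h.le_right)
    · rw [sum_isSplit_eq_zero kap.2 hh, horizontalWeight,
        if_neg (not_and_of_not_left _ hh), ite_self, smul_zero]
  · simp only [if_neg hn, Finset.sum_const_zero]
    rw [horizontalWeight, if_neg (not_and_of_not_right _ hn), ite_self, smul_zero]

/-! ### Expansions indexed by compositions -/

theorem partialSumProd_append_singleton (l : List ℕ) (k : ℕ) :
    partialSumProd (l ++ [k]) = partialSumProd l * (l.sum + k) := by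
  rw [partialSumProd, List.length_append, List.length_singleton, Finset.prod_range_succ]
  congr 1
  · refine Finset.prod_congr rfl fun i hi => ?_
    rw [List.take_append_of_le_length (Finset.mem_range.1 hi)]
  · rw [List.take_of_length_le (by simp), List.sum_append, List.sum_singleton]

/-- Append a last part to a composition of `k < n` in order to get a composition of `n`. -/
def appendLast (n : ℕ) (x : Σ k : Fin n, Composition k) : Composition n where
  blocks := x.2.blocks ++ [n - x.1]
  blocks_pos := by
    intro i hi
    rcases List.mem_append.1 hi with h | h
    · exact x.2.blocks_pos h
    · rw [List.mem_singleton.1 h]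
      have := x.1.2
      omega
  blocks_sum := by
    have := x.1.2
    rw [List.sum_append, x.2.blocks_sum, List.sum_singleton]
    omega

theorem appendLast_bijective {n : ℕ} (hn : n ≠ 0) : Function.Bijective (appendLast n) := by
  constructor
  · rintro ⟨k, α⟩ ⟨k', α'⟩ h
    have h1 := congrArg Composition.blocks h
    obtain ⟨h2, -⟩ := List.append_inj' h1 rfl
    have h3 : (k : ℕ) = k' := by
      rw [← α.blocks_sum, ← α'.blocks_sum, h2]
    obtain rfl : k = k' := Fin.ext h3
    obtain rfl : α = α' := Composition.ext h2
    rfl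
  · intro β
    rcases List.eq_nil_or_concat β.blocks with h | ⟨l, k, h⟩
    · have := β.blocks_sum
      rw [h] at this
      exact absurd this.symm hn
    · rw [List.concat_eq_append] at h
      have hs := β.blocks_sum
      rw [h, List.sum_append, List.sum_singleton] at hs
      have hk : 0 < k := β.blocks_pos (by rw [h]; simp)
      refine ⟨⟨⟨l.sum, by omega⟩, ⟨l, fun {i} hi => β.blocks_pos (by rw [h]; simp [hi]), rfl⟩⟩, ?_⟩
      refine Composition.ext (Eq.trans ?_ h.symm)
      change l ++ [n - l.sum] = l ++ [k]
      rw [show n - l.sum = k by omega]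

/-- Distributivity for ordered products: the step matrices need not commute, so list products
replace `Finset` products. -/
theorem list_prod_ofFn_sum {A : Type*} [Semiring A] {m : ℕ} {ι : Fin m → Type*} [∀ i, Fintype (ι i)]
    (f : ∀ i, ι i → A) : (List.ofFn fun i => ∑ j, f i j).prod =
      ∑ p : ∀ i, ι i, (List.ofFn fun i => f i (p i)).prod := by
  induction m with
  | zero => simp
  | succ m ih =>
    rw [List.ofFn_succ, List.prod_cons, ih, ← (Fin.consEquiv ι).sum_comp,
      Fintype.sum_prod_type, Finset.sum_mul_sum]
    refine Finset.sum_congr rfl fun j _ => Finset.sum_congr rfl fun p _ => ?_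
    rw [List.ofFn_succ, List.prod_cons]
    rfl

section

variable {R : Type*} [Ring R] [Algebra ℂ R]

/-- Each use of the recursion splits off the last part `n - k` of the composition. The factor `n⁻¹`
it costs is the inverse of the full partial sum, which is the last factor of `partialSumProd`. -/
theorem eq_sum_composition (H B : ℕ → R) (h0 : H 0 = 1)
    (hrec : ∀ n : ℕ, (n : ℂ) • H n = ∑ k : Fin n, H k * B (n - k)) (n : ℕ) :
    H n = ∑ α : Composition n, (partialSumProd α.blocks : ℂ)⁻¹ • (α.blocks.map B).prod := by
  induction n using Nat.strong_induction_on with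
  | _ n ih =>
    rcases eq_or_ne n 0 with rfl | hn
    · have : Subsingleton (Composition 0) :=
        Fintype.card_le_one_iff_subsingleton.1 (by rw [composition_card]; rfl)
      rw [Fintype.sum_subsingleton _ (Composition.ones 0), h0]
      simp [partialSumProd, Composition.ones]
    · have hn' : (n : ℂ) ≠ 0 := Nat.cast_ne_zero.2 hn
      rw [← (appendLast_bijective hn).sum_comp, Fintype.sum_sigma]
      have h1 : H n = (n : ℂ)⁻¹ • ∑ k : Fin n, H k * B (n - k) := by
        rw [← hrec, smul_smul, inv_mul_cancel₀ hn', one_smul]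
      rw [h1, Finset.smul_sum]
      refine Finset.sum_congr rfl fun k _ => ?_
      rw [ih k k.2, Finset.sum_mul, Finset.smul_sum]
      refine Finset.sum_congr rfl fun α _ => ?_
      change _ = ((partialSumProd (α.blocks ++ [n - k]) : ℕ) : ℂ)⁻¹ •
        ((α.blocks ++ [n - k]).map B).prod
      rw [partialSumProd_append_singleton, α.blocks_sum, List.map_append, List.prod_append,
        List.map_singleton, List.prod_singleton, Nat.add_sub_cancel' k.2.le, Nat.cast_mul,
        mul_inv, smul_mul_assoc, smul_smul, mul_comm (n : ℂ)⁻¹]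

theorem list_prod_map_smul {ι : Type*} (L : List ι) (c : ι → ℕ) (x : ι → R) :
    (L.map fun l => (c l : ℂ)⁻¹ • x l).prod =
      (((L.map c).prod : ℕ) : ℂ)⁻¹ • (L.map x).prod := by
  induction L with
  | nil => simp
  | cons a L ih =>
    simp only [List.map_cons, List.prod_cons]
    rw [ih, Nat.cast_mul, mul_inv, smul_mul_smul_comm]

/-- A composition together with a grouping of its parts amounts to a coarsening `c` and a
composition of each part of `c` (`Composition.sigmaEquivSigmaPi`). Expanding every factor `H (β_i)`
therefore runs over the pairs `(α, b)` that gather to `β`. -/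
theorem prod_eq_sum_gather (H B : ℕ → R)
    (h : ∀ n, H n = ∑ α : Composition n,
      (partialSumProd α.blocks : ℂ)⁻¹ • (α.blocks.map B).prod)
    {n : ℕ} (β : Composition n) :
    (β.blocks.map H).prod = ∑ α : Composition n, ∑ b : Composition α.length,
      if α.gather b = β then (coarseningProd α b : ℂ)⁻¹ • (α.blocks.map B).prod else 0 := by
  classical
  set φ : List ℕ → R := fun l => (partialSumProd l : ℂ)⁻¹ • (l.map B).prod with hφ
  have key : ∑ x : (Σ α : Composition n, Composition α.length),
      (if x.1.gather x.2 = β then (coarseningProd x.1 x.2 : ℂ)⁻¹ • (x.1.blocks.map B).prod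
        else 0) =
      ∑ y : (Σ c : Composition n, ∀ i : Fin c.length, Composition (c.blocksFun i)),
        if y.1 = β then ((List.ofFn fun j => (y.2 j).blocks).map φ).prod else 0 := by
    refine Fintype.sum_equiv (Composition.sigmaEquivSigmaPi n) _ _ ?_
    rintro ⟨α, b⟩
    have h1 : (List.ofFn fun j => (((Composition.sigmaEquivSigmaPi n) ⟨α, b⟩).2 j).blocks) =
        α.blocks.splitWrtComposition b := by
      refine List.ext_getElem ?_ fun i hi hi' => ?_
      · simp [Composition.sigmaEquivSigmaPi, Composition.length_gather]
      · rw [List.getElem_ofFn]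
        rfl
    rw [h1]
    change _ = if α.gather b = β then _ else _
    refine if_congr Iff.rfl ?_ rfl
    rw [hφ, list_prod_map_smul, coarseningProd]
    congr 1
    -- The product along `α` is the product, in order, of the products along its groups.
    conv_lhs => rw [← List.flatten_splitWrtComposition α.blocks b]
    rw [List.map_flatten, List.prod_flatten, List.map_map]
    rfl
  rw [← Fintype.sum_sigma', key, Fintype.sum_sigma, Finset.sum_eq_single β]
  · simp only [if_true, List.map_ofFn]
    refine Eq.trans ?_ (list_prod_ofFn_sum (fun i (α : Composition (β.blocksFun i)) => φ α.blocks))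
    rw [← Composition.ofFn_blocksFun, List.map_ofFn]
    congr 2
    funext i
    exact h _
  · intro c _ hc
    exact Finset.sum_eq_zero fun p _ => if_neg hc
  · simp

end

/-! ### Weakly increasing fillings and products of step matrices -/

/-- Weakly increasing fillings of `lam / mu` with entries in `1, ..., l`, extended by `0`. -/
structure IsFilling (lam mu : YoungDiagram) (l : ℕ) (f : ℕ × ℕ → ℕ) : Prop where
  zero : ∀ c, c ∉ skewCells lam mu → f c = 0
  pos : ∀ c ∈ skewCells lam mu, 1 ≤ f c
  le : ∀ c ∈ skewCells lam mu, f c ≤ l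
  mono : ∀ c ∈ skewCells lam mu, ∀ c' ∈ skewCells lam mu, c ≤ c' → f c ≤ f c'

instance finite_isFilling (lam mu : YoungDiagram) (l : ℕ) :
    Finite {f : ℕ × ℕ → ℕ // IsFilling lam mu l f} := by
  refine Finite.of_injective
    (fun f (c : skewCells lam mu) => (⟨f.1 c.1, Nat.lt_succ_of_le (f.2.le c.1 c.2)⟩ : Fin (l + 1)))
    fun f g h => Subtype.ext (funext fun c => ?_)
  by_cases hc : c ∈ skewCells lam mu
  · exact congrArg Fin.val (congrFun h ⟨c, hc⟩)
  · rw [f.2.zero c hc, g.2.zero c hc]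

noncomputable instance (lam mu : YoungDiagram) (l : ℕ) :
    Fintype {f : ℕ × ℕ → ℕ // IsFilling lam mu l f} := Fintype.ofFinite _

/-- The cells of `lam / mu` at which `f` takes the value `i`. -/
def level (lam mu : YoungDiagram) (f : ℕ × ℕ → ℕ) (i : ℕ) : Finset (ℕ × ℕ) :=
  (skewCells lam mu).filter (fun c => f c = i)

theorem mem_skewCells' {lam mu : YoungDiagram} {c : ℕ × ℕ} :
    c ∈ skewCells lam mu ↔ c ∈ lam ∧ c ∉ mu := by
  simp [skewCells]

theorem mem_of_le {lam : YoungDiagram} {c c' : ℕ × ℕ} (h : c ≤ c') (hc : c' ∈ lam) : c ∈ lam :=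
  lam.isLowerSet h hc

theorem skewCells_self (lam : YoungDiagram) : skewCells lam lam = ∅ := by
  simp [skewCells]

open Classical in
/-- The union of `mu` and the cells of `lam / mu` with entries at most `l`. -/
noncomputable def IsFilling.below {lam mu : YoungDiagram} {m : ℕ} {f : ℕ × ℕ → ℕ}
    (h : IsFilling lam mu m f) (l : ℕ) : YoungDiagram where
  cells := lam.cells.filter (fun c => c ∈ mu ∨ f c ≤ l)
  isLowerSet := by
    intro c c' hle hc
    simp only [Finset.coe_filter, Set.mem_ofPred_eq, YoungDiagram.mem_cells] at hc ⊢
    refine ⟨mem_of_le hle hc.1, ?_⟩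
    by_cases hmu : c' ∈ mu
    · exact Or.inl hmu
    · have hcmu : c ∉ mu := fun hcm => hmu (mem_of_le hle hcm)
      exact Or.inr ((h.mono c' (mem_skewCells'.2 ⟨mem_of_le hle hc.1, hmu⟩) c
        (mem_skewCells'.2 ⟨hc.1, hcmu⟩) hle).trans (hc.2.resolve_left hcmu))

theorem IsFilling.mem_below {lam mu : YoungDiagram} {m : ℕ} {f : ℕ × ℕ → ℕ}
    (h : IsFilling lam mu m f) {l : ℕ} {c : ℕ × ℕ} :
    c ∈ h.below l ↔ c ∈ lam ∧ (c ∈ mu ∨ f c ≤ l) := by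
  rw [← YoungDiagram.mem_cells]
  simp [IsFilling.below]

theorem IsFilling.below_le {lam mu : YoungDiagram} {m : ℕ} {f : ℕ × ℕ → ℕ}
    (h : IsFilling lam mu m f) (l : ℕ) : h.below l ≤ lam := fun _ hc => (h.mem_below.1 hc).1

theorem IsFilling.le_below {lam mu : YoungDiagram} {m : ℕ} {f : ℕ × ℕ → ℕ}
    (h : IsFilling lam mu m f) (hmu : mu ≤ lam) (l : ℕ) : mu ≤ h.below l :=
  fun _ hc => h.mem_below.2 ⟨hmu hc, Or.inl hc⟩

open Classical in
theorem IsFilling.restrict {lam mu rho : YoungDiagram} {l : ℕ} {f : ℕ × ℕ → ℕ}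
    (h : IsFilling lam mu (l + 1) f) (hr : h.below l = rho) :
    IsFilling rho mu l (fun c => if c ∈ rho then f c else 0) := by
  have hmem : ∀ c ∈ skewCells rho mu, c ∈ skewCells lam mu ∧ f c ≤ l := by
    intro c hc
    rw [mem_skewCells', ← hr, h.mem_below] at hc
    exact ⟨mem_skewCells'.2 ⟨hc.1.1, hc.2⟩, hc.1.2.resolve_left hc.2⟩
  refine ⟨fun c hc => ?_, fun c hc => ?_, fun c hc => ?_, fun c hc c' hc' hle => ?_⟩
  · split_ifs with h1
    · refine h.zero c fun h2 => hc (mem_skewCells'.2 ⟨h1, (mem_skewCells'.1 h2).2⟩)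
    · rfl
  · simp only [if_pos (mem_skewCells'.1 hc).1]
    exact h.pos c (hmem c hc).1
  · simp only [if_pos (mem_skewCells'.1 hc).1]
    exact (hmem c hc).2
  · simp only [if_pos (mem_skewCells'.1 hc).1, if_pos (mem_skewCells'.1 hc').1]
    exact h.mono c (hmem c hc).1 c' (hmem c' hc').1 hle

open Classical in
theorem IsFilling.extend {lam mu rho : YoungDiagram} {l : ℕ} {g : ℕ × ℕ → ℕ}
    (h : IsFilling rho mu l g) (h1 : mu ≤ rho) (h2 : rho ≤ lam) :
    IsFilling lam mu (l + 1)
      (fun c => if c ∈ rho then g c else if c ∈ lam then l + 1 else 0) := by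
  refine ⟨fun c hc => ?_, fun c hc => ?_, fun c hc => ?_, fun c hc c' hc' hle => ?_⟩
  · have hcr : c ∉ skewCells rho mu := fun hc' =>
      hc (mem_skewCells'.2 ⟨h2 (mem_skewCells'.1 hc').1, (mem_skewCells'.1 hc').2⟩)
    split_ifs with h3 h4
    · exact h.zero c hcr
    · exact absurd (mem_skewCells'.2 ⟨h4, fun hmu => h3 (h1 hmu)⟩) hc
    · rfl
  · rw [mem_skewCells'] at hc
    split_ifs with h3
    · exact h.pos c (mem_skewCells'.2 ⟨h3, hc.2⟩)
    · omega
    · exact absurd hc.1 ‹_›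
  · rw [mem_skewCells'] at hc
    split_ifs with h3
    · exact (h.le c (mem_skewCells'.2 ⟨h3, hc.2⟩)).trans (by omega)
    · omega
    · omega
  · rw [mem_skewCells'] at hc hc'
    by_cases h3 : c' ∈ rho
    · have h4 : c ∈ rho := mem_of_le hle h3
      simp only [if_pos h3, if_pos h4]
      exact h.mono c (mem_skewCells'.2 ⟨h4, hc.2⟩) c' (mem_skewCells'.2 ⟨h3, hc'.2⟩) hle
    · simp only [if_neg h3, if_pos hc'.1]
      split_ifs with h4
      · exact (h.le c (mem_skewCells'.2 ⟨h4, hc.2⟩)).trans (by omega)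
      · exact le_rfl
      · omega

open Classical in
theorem IsFilling.below_extend {lam mu rho : YoungDiagram} {l : ℕ} {g : ℕ × ℕ → ℕ}
    (h : IsFilling rho mu l g) (h1 : mu ≤ rho) (h2 : rho ≤ lam) :
    (h.extend h1 h2).below l = rho := by
  refine SetLike.ext fun c => ?_
  rw [IsFilling.mem_below]
  constructor
  · rintro ⟨hc, hc' | hc'⟩
    · exact h1 hc'
    · by_contra hr
      rw [if_neg hr, if_pos hc] at hc'
      omega
  · intro hc
    refine ⟨h2 hc, or_iff_not_imp_left.2 fun hmu => ?_⟩
    rw [if_pos hc]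
    exact h.le c (mem_skewCells'.2 ⟨hc, hmu⟩)

open Classical in
theorem IsFilling.level_restrict {lam mu rho : YoungDiagram} {l : ℕ} {f : ℕ × ℕ → ℕ}
    (h : IsFilling lam mu (l + 1) f) (hr : h.below l = rho) {i : ℕ} (hi : i ≤ l) :
    level lam mu f i = level rho mu (fun c => if c ∈ rho then f c else 0) i := by
  ext c
  have hb := h.mem_below (l := l) (c := c)
  rw [hr] at hb
  simp only [level, Finset.mem_filter, mem_skewCells']
  constructor
  · rintro ⟨⟨h1, h2⟩, h3⟩
    have h4 : c ∈ rho := hb.2 ⟨h1, Or.inr (by omega)⟩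
    exact ⟨⟨h4, h2⟩, by rw [if_pos h4, h3]⟩
  · rintro ⟨⟨h1, h2⟩, h3⟩
    rw [if_pos h1] at h3
    exact ⟨⟨(hb.1 h1).1, h2⟩, h3⟩

theorem IsFilling.level_top {lam mu rho : YoungDiagram} {l : ℕ} {f : ℕ × ℕ → ℕ}
    (h : IsFilling lam mu (l + 1) f) (hr : h.below l = rho) :
    level lam mu f (l + 1) = skewCells lam rho := by
  ext c
  have hb := h.mem_below (l := l) (c := c)
  rw [hr] at hb
  simp only [level, Finset.mem_filter, mem_skewCells', hb]
  constructor
  · rintro ⟨⟨h1, h2⟩, h3⟩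
    exact ⟨h1, fun h4 => h4.2.elim h2 (by omega)⟩
  · rintro ⟨h1, h2⟩
    have h3 : c ∉ mu := fun h3 => h2 ⟨h1, Or.inl h3⟩
    have h4 := h.le c (mem_skewCells'.2 ⟨h1, h3⟩)
    have h5 : ¬ f c ≤ l := fun h5 => h2 ⟨h1, Or.inr h5⟩
    exact ⟨⟨h1, h3⟩, by omega⟩

open Classical in
-- A weakly increasing filling is the same as its chain of diagrams `below 0 ≤ below 1 ≤ ...` from
-- `mu` to `lam`, and expanding a matrix product sums over such chains. The induction removes the
-- largest label `l + 1`: the intermediate index `rho` is `below l`, and `restrict` and `extend` are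
-- inverse bijections on its fibre.
theorem prod_stepMatrix_apply (Lam : YoungDiagram) (w : ℕ → Finset (ℕ × ℕ) → ℂ) (l : ℕ)
    (mu lam : Set.Iic Lam) :
    ((List.range l).map fun i => stepMatrix Lam (w i)).prod mu lam =
      if mu.1 ≤ lam.1 then ∑ f : {f : ℕ × ℕ → ℕ // IsFilling lam.1 mu.1 l f},
        ∏ i ∈ Finset.range l, w i (level lam.1 mu.1 f.1 (i + 1)) else 0 := by
  induction l generalizing lam with
  | zero =>
    rw [List.range_zero, List.map_nil, List.prod_nil, Matrix.one_apply]
    rcases eq_or_ne mu lam with rfl | hne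
    · rw [if_pos rfl, if_pos le_rfl]
      simp only [Finset.range_zero, Finset.prod_empty, Finset.sum_const, Finset.card_univ,
        nsmul_eq_mul, mul_one]
      have hc : ∀ c, c ∉ skewCells mu.1 mu.1 := fun c => by rw [skewCells_self]; simp
      have : Fintype.card {f : ℕ × ℕ → ℕ // IsFilling mu.1 mu.1 0 f} = 1 := by
        refine Fintype.card_eq_one_iff.2 ⟨⟨fun _ => 0, fun _ _ => rfl,
          fun c h => absurd h (hc c), fun c h => absurd h (hc c),
          fun c h => absurd h (hc c)⟩, fun f => Subtype.ext (funext fun c => f.2.zero c (hc c))⟩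
      rw [this, Nat.cast_one]
    · rw [if_neg hne]
      split_ifs with hle
      -- A nonempty shape has no filling with labels at least 1 and at most 0.
      · symm
        have hex : ∃ c, c ∈ skewCells lam.1 mu.1 := by
          by_contra hcon
          refine hne (Subtype.ext (le_antisymm hle fun c hc => ?_))
          by_contra hcm
          exact hcon ⟨c, mem_skewCells'.2 ⟨hc, hcm⟩⟩
        obtain ⟨c, hc⟩ := hex
        refine Finset.sum_eq_zero fun f _ => ?_
        have h1 := f.2.pos c hc
        have h2 := f.2.le c hc
        omega
      · rfl
  | succ l ih =>
    rw [List.range_succ, List.map_append, List.prod_append, List.map_singleton,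
      List.prod_singleton, Matrix.mul_apply]
    by_cases hle : mu.1 ≤ lam.1
    · rw [if_pos hle, ← Finset.sum_fiberwise _
        (fun f : {f : ℕ × ℕ → ℕ // IsFilling lam.1 mu.1 (l + 1) f} =>
          (⟨f.2.below l, (f.2.below_le l).trans lam.2⟩ : Set.Iic Lam))]
      refine Finset.sum_congr rfl fun rho _ => ?_
      rw [ih, stepMatrix, Matrix.of_apply]
      by_cases hr : mu.1 ≤ rho.1 ∧ rho.1 ≤ lam.1
      · rw [if_pos hr.1, if_pos hr.2, Finset.sum_mul]
        symm
        have hbel : ∀ f : {f : ℕ × ℕ → ℕ // IsFilling lam.1 mu.1 (l + 1) f},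
            (⟨f.2.below l, (f.2.below_le l).trans lam.2⟩ : Set.Iic Lam) = rho →
            f.2.below l = rho.1 := fun f hf => congrArg Subtype.val hf
        refine Finset.sum_bij' (fun f hf => ⟨_, f.2.restrict (hbel f (Finset.mem_filter.1 hf).2)⟩)
          (fun g _ => ⟨_, g.2.extend hr.1 hr.2⟩) ?_ ?_ ?_ ?_ ?_
        · exact fun _ _ => Finset.mem_univ _
        · intro g _
          exact Finset.mem_filter.2 ⟨Finset.mem_univ _,
            Subtype.ext (g.2.below_extend hr.1 hr.2)⟩
        · intro f hf
          refine Subtype.ext (funext fun c => ?_)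
          have hb := f.2.mem_below (l := l) (c := c)
          rw [hbel f (Finset.mem_filter.1 hf).2] at hb
          simp only
          split_ifs with h1 h2
          · rfl
          · have h3 : c ∉ mu.1 := fun h3 => h1 (hr.1 h3)
            have h4 := f.2.le c (mem_skewCells'.2 ⟨h2, h3⟩)
            have h5 : ¬ f.1 c ≤ l := fun h5 => h1 (hb.2 ⟨h2, Or.inr h5⟩)
            omega
          · exact (f.2.zero c fun h3 => h2 (mem_skewCells'.1 h3).1).symm
        · intro g _
          refine Subtype.ext (funext fun c => ?_)
          simp only
          split_ifs with h1
          · rfl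
          · exact (g.2.zero c fun h3 => h1 (mem_skewCells'.1 h3).1).symm
        · intro f hf
          rw [Finset.prod_range_succ, f.2.level_top (hbel f (Finset.mem_filter.1 hf).2)]
          congr 1
          refine Finset.prod_congr rfl fun i hi => ?_
          rw [f.2.level_restrict (hbel f (Finset.mem_filter.1 hf).2) (Finset.mem_range.1 hi)]
      · rw [Finset.filter_false_of_mem, Finset.sum_empty]
        · rcases not_and_or.1 hr with h | h
          · rw [if_neg h, zero_mul]
          · rw [if_neg h, mul_zero]
        · rintro f - rfl
          exact hr ⟨f.2.le_below hle l, f.2.below_le l⟩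
    · rw [if_neg hle]
      refine Finset.sum_eq_zero fun rho _ => ?_
      rw [ih, stepMatrix, Matrix.of_apply]
      split_ifs with h1 h2
      · exact absurd (h1.trans h2) hle
      all_goals simp

/-! ### Tableaux as fillings -/

open Classical in
/-- The extension by zero of a filling of `lam / mu`. -/
noncomputable def extendZero {lam mu : YoungDiagram} (e : skewCells lam mu → ℕ+) :
    ℕ × ℕ → ℕ := fun c => if h : c ∈ skewCells lam mu then (e ⟨c, h⟩ : ℕ) else 0

theorem extendZero_apply {lam mu : YoungDiagram} (e : skewCells lam mu → ℕ+)
    (c : skewCells lam mu) : extendZero e c.1 = e c := by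
  rw [extendZero, dif_pos c.2]

theorem extendZero_injective {lam mu : YoungDiagram} :
    Function.Injective (extendZero (lam := lam) (mu := mu)) := by
  intro e e' h
  funext c
  have := congrFun h c.1
  rw [extendZero_apply, extendZero_apply] at this
  exact PNat.coe_injective this

theorem mem_occupied {lam mu : YoungDiagram} {e : skewCells lam mu → ℕ+} {i : ℕ+} {c : ℕ × ℕ} :
    c ∈ occupied e i ↔ ∃ h : c ∈ skewCells lam mu, e ⟨c, h⟩ = i := by
  simp [occupied]

theorem level_extendZero {lam mu : YoungDiagram} (e : skewCells lam mu → ℕ+) (i : ℕ+) :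
    level lam mu (extendZero e) i = occupied e i := by
  ext c
  rw [mem_occupied, level, Finset.mem_filter]
  constructor
  · rintro ⟨h1, h2⟩
    exact ⟨h1, PNat.coe_injective ((extendZero_apply e ⟨c, h1⟩).symm.trans h2)⟩
  · rintro ⟨h1, h2⟩
    exact ⟨h1, (extendZero_apply e ⟨c, h1⟩).trans (congrArg PNat.val h2)⟩

/-- Comparable cells `(i, j) ≤ (i', j')` are linked through the corner `(i, j')`, which lies in the
skew shape as well. -/
theorem monotone_of_weak {lam mu : YoungDiagram} {e : skewCells lam mu → ℕ+}
    (hrow : ∀ c c' : skewCells lam mu, c.1.1 = c'.1.1 → c.1.2 ≤ c'.1.2 → e c ≤ e c')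
    (hcol : ∀ c c' : skewCells lam mu, c.1.2 = c'.1.2 → c.1.1 ≤ c'.1.1 → e c ≤ e c') :
    Monotone e := by
  rintro ⟨⟨i, j⟩, hc⟩ ⟨⟨i', j'⟩, hc'⟩ hle
  obtain ⟨hi, hj⟩ : i ≤ i' ∧ j ≤ j' := hle
  have hm : (i, j') ∈ skewCells lam mu := by
    rw [mem_skewCells'] at hc hc' ⊢
    exact ⟨mem_of_le (Prod.mk_le_mk.2 ⟨hi, le_rfl⟩) hc'.1,
      fun h => hc.2 (mem_of_le (Prod.mk_le_mk.2 ⟨le_rfl, hj⟩) h)⟩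
  exact (hrow ⟨_, hc⟩ ⟨_, hm⟩ rfl hj).trans (hcol ⟨_, hm⟩ ⟨_, hc'⟩ rfl hi)

theorem isFilling_extendZero {lam mu : YoungDiagram} {e : skewCells lam mu → ℕ+}
    (h : Monotone e) {l : ℕ} (hl : ∀ c, (e c : ℕ) ≤ l) : IsFilling lam mu l (extendZero e) := by
  refine ⟨fun c hc => dif_neg hc, fun c hc => ?_, fun c hc => ?_, fun c hc c' hc' hle => ?_⟩
  · rw [extendZero_apply e ⟨c, hc⟩]
    exact (e _).2
  · rw [extendZero_apply e ⟨c, hc⟩]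
    exact hl _
  · rw [extendZero_apply e ⟨c, hc⟩, extendZero_apply e ⟨c', hc'⟩]
    exact h (show (⟨c, hc⟩ : skewCells lam mu) ≤ ⟨c', hc'⟩ from hle)

theorem IsFilling.exists_extendZero {lam mu : YoungDiagram} {l : ℕ} {f : ℕ × ℕ → ℕ}
    (h : IsFilling lam mu l f) : ∃ e : skewCells lam mu → ℕ+,
      extendZero e = f ∧ Monotone e ∧ ∀ c, (e c : ℕ) ≤ l := by
  refine ⟨fun c => ⟨f c.1, h.pos c.1 c.2⟩, funext fun c => ?_, fun c c' hle => ?_,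
    fun c => h.le c.1 c.2⟩
  · by_cases hc : c ∈ skewCells lam mu
    · exact dif_pos hc
    · rw [h.zero c hc]
      exact dif_neg hc
  · exact h.mono c.1 c.2 c'.1 c'.2 hle

/-! ### Border-strip tableaux -/

/-- The product of the border strip matrices of sizes the parts of `α`. -/
noncomputable def borderProd (Lam : YoungDiagram) (l : List ℕ) :
    Matrix (Set.Iic Lam) (Set.Iic Lam) ℂ :=
  (l.map fun k => stepMatrix Lam (borderWeight k)).prod

theorem list_map_eq_range_map {A : Type*} (l : List ℕ) (g : ℕ → A) :
    l.map g = (List.range l.length).map fun i => g (l.getD i 0) := by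
  refine List.ext_getElem (by simp) fun i hi hi' => ?_
  simp only [List.length_map] at hi
  simp [hi]

theorem BorderStripTableau.height_eq {lam mu : YoungDiagram} {n : ℕ} {α : Composition n}
    (T : BorderStripTableau lam mu α) : T.height = ∑ i ∈ Finset.range α.blocks.length,
      stripHeight (level lam mu (extendZero T.entry) (i + 1)) := by
  -- The parts of `α` are positive, so each label from 1 to the length of `α` really occurs.
  have h : Finset.univ.image T.entry = (Finset.range α.blocks.length).image Nat.succPNat := by
    ext i
    simp only [Finset.mem_image, Finset.mem_univ, true_and, Finset.mem_range]
    constructor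
    · rintro ⟨c, rfl⟩
      have h1 : (T.entry c : ℕ) ≤ α.blocks.length := T.entry_le c
      have h2 := (T.entry c).2
      have h3 := PNat.natPred_add_one (T.entry c)
      exact ⟨PNat.natPred (T.entry c), by omega, PNat.succPNat_natPred _⟩
    · rintro ⟨k, hk, rfl⟩
      have h1 := T.card_occupied k.succPNat
      rw [Nat.succPNat_coe, Nat.succ_sub_one, List.getD_eq_getElem _ _ hk] at h1
      have h2 : 0 < α.blocks[k] := α.blocks_pos (List.getElem_mem hk)
      obtain ⟨c, hc⟩ := Finset.card_pos.1 (h1 ▸ h2)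
      obtain ⟨h3, h4⟩ := mem_occupied.1 hc
      exact ⟨_, h4⟩
  rw [BorderStripTableau.height, h, Finset.sum_image fun _ _ _ _ e => Nat.succPNat_injective e]
  refine Finset.sum_congr rfl fun i _ => ?_
  rw [← level_extendZero]
  rfl

/-- The product of weights vanishes on a filling unless every level is a border strip of the
prescribed size, that is, unless the filling is a border-strip tableau; there it equals the sign.
Labels start at 1 and list positions at 0, so label `i + 1` goes with position `i`. -/
theorem chi_eq_borderProd {lam mu : YoungDiagram} (hmu : mu ≤ lam) {n : ℕ} (α : Composition n) :
    (chi lam mu α : ℂ) = borderProd lam α.blocks ⟨mu, hmu⟩ ⟨lam, Set.mem_Iic.2 le_rfl⟩ := by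
  classical
  rw [borderProd, list_map_eq_range_map, prod_stepMatrix_apply, if_pos hmu, chi, Int.cast_sum]
  have hfill : ∀ T : BorderStripTableau lam mu α,
      IsFilling lam mu α.blocks.length (extendZero T.entry) := fun T =>
    isFilling_extendZero (monotone_of_weak T.row_weak T.col_weak) T.entry_le
  refine Finset.sum_of_injOn (fun T => ⟨extendZero T.entry, hfill T⟩) ?_ ?_ ?_ ?_
  · intro T _ T' _ h
    exact BorderStripTableau.ext (extendZero_injective (congrArg Subtype.val h))
  · exact fun _ _ => Finset.mem_coe.2 (Finset.mem_univ _)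
  · intro f _ hf
    by_contra hne
    refine hf ?_
    obtain ⟨e, he, hmono, hle⟩ := f.2.exists_extendZero
    have hw : ∀ i < α.blocks.length, IsBorderStrip (level lam mu f.1 (i + 1)) ∧
        (level lam mu f.1 (i + 1)).card = α.blocks.getD i 0 := by
      intro i hi
      by_contra hcon
      refine hne (Finset.prod_eq_zero (Finset.mem_range.2 hi) ?_)
      rw [borderWeight, if_neg hcon]
    have hocc : ∀ i : ℕ+, (i : ℕ) ≤ α.blocks.length → IsBorderStrip (occupied e i) ∧
        (occupied e i).card = α.blocks.getD ((i : ℕ) - 1) 0 := by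
      intro i hi
      have h1 : 1 ≤ (i : ℕ) := i.2
      have := hw ((i : ℕ) - 1) (by omega)
      rwa [Nat.sub_add_cancel h1, ← he, level_extendZero] at this
    refine ⟨⟨e, fun c c' h1 h2 => hmono (Prod.mk_le_mk.2 ⟨h1.le, h2⟩),
      fun c c' h1 h2 => hmono (Prod.mk_le_mk.2 ⟨h2, h1.le⟩), fun i => ?_, fun i hi => ?_⟩,
      Finset.mem_coe.2 (Finset.mem_univ _), Subtype.ext he⟩
    · by_cases hi : (i : ℕ) ≤ α.blocks.length
      · exact (hocc i hi).2
      · rw [List.getD_eq_default _ _ (by omega), Finset.card_eq_zero]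
        refine Finset.eq_empty_of_forall_notMem fun c hc => ?_
        obtain ⟨h1, rfl⟩ := mem_occupied.1 hc
        exact hi (hle _)
    · obtain ⟨c, hc⟩ := hi
      obtain ⟨h1, rfl⟩ := mem_occupied.1 hc
      exact (hocc _ (hle _)).1
  · intro T _
    rw [Int.cast_pow, Int.cast_neg, Int.cast_one, T.height_eq, ← Finset.prod_pow_eq_pow_sum]
    refine Finset.prod_congr rfl fun i hi => ?_
    have hi' := Finset.mem_range.1 hi
    have hl : level lam mu (extendZero T.entry) (i + 1) = occupied T.entry i.succPNat :=
      level_extendZero T.entry i.succPNat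
    have hcard := T.card_occupied i.succPNat
    rw [Nat.succPNat_coe, Nat.succ_sub_one] at hcard
    have hpos : 0 < α.blocks.getD i 0 := by
      rw [List.getD_eq_getElem _ _ hi']
      exact α.blocks_pos (List.getElem_mem hi')
    simp only [hl]
    rw [borderWeight, if_pos ⟨T.strip _ (Finset.card_pos.1 (hcard ▸ hpos)), hcard⟩]

/-! ### Semistandard tableaux -/

theorem SkewSSYT.content_apply {lam mu : YoungDiagram} (T : SkewSSYT lam mu) (i : ℕ+) :
    T.content i = (occupied T.entry i).card := by
  classical
  rw [SkewSSYT.content, Finsupp.finsetSum_apply, occupied, Finset.card_map, Finset.card_filter]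
  exact Finset.sum_congr rfl fun c _ => Finsupp.single_apply

theorem SkewSSYT.monotone {lam mu : YoungDiagram} (T : SkewSSYT lam mu) : Monotone T.entry := by
  refine monotone_of_weak T.row_weak fun c c' h1 h2 => ?_
  rcases h2.lt_or_eq with h2 | h2
  · exact (T.col_strict c c' h1 h2).le
  · rw [Subtype.ext (Prod.ext h2 h1)]

theorem SkewSSYT.isHorizontalStrip {lam mu : YoungDiagram} (T : SkewSSYT lam mu) (i : ℕ+) :
    IsHorizontalStrip (occupied T.entry i) := by
  intro c hc c' hc' h
  obtain ⟨h1, h2⟩ := mem_occupied.1 hc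
  obtain ⟨h1', h2'⟩ := mem_occupied.1 hc'
  rcases lt_trichotomy c.1 c'.1 with hlt | heq | hlt
  · exact absurd (h2.trans h2'.symm) (T.col_strict ⟨c, h1⟩ ⟨c', h1'⟩ h hlt).ne
  · exact Prod.ext heq h
  · exact absurd (h2'.trans h2.symm) (T.col_strict ⟨c', h1'⟩ ⟨c, h1⟩ h.symm hlt).ne

/-- A weakly increasing filling is column-strict exactly when all its levels are horizontal strips.
The bound `N` makes the product finite; variables below it may have exponent zero. -/
theorem card_ssyt_eq_prod {lam mu : YoungDiagram} (hmu : mu ≤ lam) (d : ℕ+ →₀ ℕ) (N : ℕ)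
    (hN : ∀ i ∈ d.support, (i : ℕ) ≤ N) :
    (Nat.card {T : SkewSSYT lam mu // T.content = d} : ℂ) =
      ((List.range N).map fun i => stepMatrix lam (horizontalWeight (d i.succPNat))).prod
        ⟨mu, hmu⟩ ⟨lam, Set.mem_Iic.2 le_rfl⟩ := by
  classical
  have : Finite {T : SkewSSYT lam mu // T.content = d} :=
    (SkewSSYT.finite_fibre lam mu d).to_subtype
  have := Fintype.ofFinite {T : SkewSSYT lam mu // T.content = d}
  rw [prod_stepMatrix_apply lam (fun i => horizontalWeight (d i.succPNat)), if_pos hmu,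
    Nat.card_eq_fintype_card, ← Finset.card_univ, Finset.cast_card]
  have hfill : ∀ T : {T : SkewSSYT lam mu // T.content = d},
      IsFilling lam mu N (extendZero T.1.entry) := by
    refine fun T => isFilling_extendZero T.1.monotone fun c => hN _ ?_
    rw [Finsupp.mem_support_iff, ← DFunLike.congr_fun T.2, SkewSSYT.content_apply]
    exact (Finset.card_pos.2 ⟨c.1, mem_occupied.2 ⟨c.2, rfl⟩⟩).ne'
  refine Finset.sum_of_injOn (fun T => ⟨extendZero T.1.entry, hfill T⟩) ?_ ?_ ?_ ?_
  · intro T _ T' _ h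
    exact Subtype.ext (SkewSSYT.ext (extendZero_injective (congrArg Subtype.val h)))
  · exact fun _ _ => Finset.mem_coe.2 (Finset.mem_univ _)
  · intro f _ hf
    by_contra hne
    refine hf ?_
    obtain ⟨e, he, hmono, hle⟩ := f.2.exists_extendZero
    have hw : ∀ i < N, IsHorizontalStrip (level lam mu f.1 (i + 1)) ∧
        (level lam mu f.1 (i + 1)).card = d i.succPNat := by
      intro i hi
      by_contra hcon
      refine hne (Finset.prod_eq_zero (Finset.mem_range.2 hi) ?_)
      rw [horizontalWeight, if_neg hcon]
    have hocc : ∀ i : ℕ+, (i : ℕ) ≤ N → IsHorizontalStrip (occupied e i) ∧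
        (occupied e i).card = d i := by
      intro i hi
      have hpred := PNat.natPred_add_one i
      have := hw i.natPred (by omega)
      rwa [PNat.succPNat_natPred, PNat.natPred_add_one, ← he, level_extendZero] at this
    refine ⟨⟨⟨e, fun c c' h1 h2 => hmono (Prod.mk_le_mk.2 ⟨h1.le, h2⟩), fun c c' h1 h2 => ?_⟩,
      ?_⟩, Finset.mem_coe.2 (Finset.mem_univ _), Subtype.ext he⟩
    · refine lt_of_le_of_ne (hmono (Prod.mk_le_mk.2 ⟨h2.le, h1.le⟩)) fun heq => ?_
      have := (hocc (e c') (hle c')).1 c.1 (mem_occupied.2 ⟨c.2, heq⟩) c'.1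
        (mem_occupied.2 ⟨c'.2, rfl⟩) h1
      rw [this] at h2
      exact lt_irrefl _ h2
    · refine Finsupp.ext fun i => ?_
      rw [SkewSSYT.content_apply]
      by_cases hi : (i : ℕ) ≤ N
      · exact (hocc i hi).2
      · have hd : d i = 0 := by
          by_contra hd
          exact hi (hN i (Finsupp.mem_support_iff.2 hd))
        rw [hd, Finset.card_eq_zero]
        refine Finset.eq_empty_of_forall_notMem fun c hc => ?_
        obtain ⟨h1, rfl⟩ := mem_occupied.1 hc
        exact hi (hle _)
  · intro T _
    refine (Finset.prod_eq_one fun i _ => ?_).symm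
    have hl : level lam mu (extendZero T.1.entry) (i + 1) = occupied T.1.entry i.succPNat :=
      level_extendZero T.1.entry i.succPNat
    have hcard : (occupied T.1.entry i.succPNat).card = d i.succPNat := by
      rw [← T.1.content_apply, T.2]
    simp only [hl]
    rw [horizontalWeight, if_pos ⟨T.1.isHorizontalStrip _, hcard⟩]

/-! ### Coefficients of skew Schur functions -/

theorem prod_filter_of_eq_one {ι A : Type*} [Monoid A] (L : List ι) (p : ι → Bool) (g : ι → A)
    (h : ∀ i, p i = false → g i = 1) : ((L.filter p).map g).prod = (L.map g).prod := by
  induction L with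
  | nil => rfl
  | cons a L ih =>
    rw [List.filter_cons]
    cases hp : p a with
    | true => simp [ih]
    | false => simp [ih, h a hp]

/-- The nonzero exponents of a monomial, in the order of the variables. -/
noncomputable def exponents (d : ℕ+ →₀ ℕ) : List ℕ := (d.support.sort (· ≤ ·)).map d

theorem sort_support_eq_filter (d : ℕ+ →₀ ℕ) (N : ℕ) (hN : ∀ i ∈ d.support, (i : ℕ) ≤ N) :
    d.support.sort (· ≤ ·) =
      ((List.range N).map Nat.succPNat).filter (fun i => decide (d i ≠ 0)) := by
  have hlt : (((List.range N).map Nat.succPNat).filter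
      (fun i => decide (d i ≠ 0))).Pairwise (· < ·) := by
    refine List.Pairwise.filter _ (List.pairwise_map.2 ?_)
    exact List.pairwise_lt_range.imp fun h => Nat.succPNat_lt_succPNat.2 h
  rw [← (List.toFinset_sort (· ≤ ·) (hlt.imp fun h => ne_of_lt h)).2 (hlt.imp fun h => le_of_lt h)]
  congr 1
  ext i
  simp only [List.mem_toFinset, List.mem_filter, List.mem_map, List.mem_range,
    decide_eq_true_eq, Finsupp.mem_support_iff]
  constructor
  · intro hi
    have h1 := hN i (Finsupp.mem_support_iff.2 hi)
    have h2 := PNat.natPred_add_one i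
    exact ⟨⟨i.natPred, by omega, PNat.succPNat_natPred i⟩, hi⟩
  · exact fun h => h.2

/-- Zero exponents contribute the identity matrix and can be dropped. The coefficient thus depends
only on the ordered list of nonzero exponents, which is quasisymmetry. -/
theorem skewSchur_apply {lam mu : YoungDiagram} (hmu : mu ≤ lam) (d : ℕ+ →₀ ℕ) :
    skewSchur lam mu d =
      ((exponents d).map fun k => stepMatrix lam (horizontalWeight k)).prod
        ⟨mu, hmu⟩ ⟨lam, Set.mem_Iic.2 le_rfl⟩ := by
  obtain ⟨N, hN⟩ : ∃ N : ℕ, ∀ i ∈ d.support, (i : ℕ) ≤ N :=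
    ⟨d.support.sup PNat.val, fun i hi => Finset.le_sup (f := PNat.val) hi⟩
  rw [exponents, sort_support_eq_filter d N hN, List.map_map, prod_filter_of_eq_one, List.map_map]
  · exact card_ssyt_eq_prod hmu d N hN
  · intro i hi
    have hd : d i = 0 := by simpa using hi
    rw [Function.comp_apply, hd, stepMatrix_horizontalWeight_zero]

/-! ### Coefficients of monomial quasisymmetric functions -/

theorem sum_single_apply {k : ℕ} {f : Fin k → ℕ+} (hf : StrictMono f) (b : Fin k → ℕ) (j : Fin k) :
    (∑ i, Finsupp.single (f i) (b i)) (f j) = b j := by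
  classical
  rw [Finsupp.finsetSum_apply, Finset.sum_eq_single j]
  · exact Finsupp.single_eq_same
  · intro i _ hi
    exact Finsupp.single_eq_of_ne fun h => hi (hf.injective h).symm
  · simp

theorem support_sum_single {k : ℕ} {f : Fin k → ℕ+} (hf : StrictMono f) {b : Fin k → ℕ}
    (hb : ∀ i, 0 < b i) : (∑ i, Finsupp.single (f i) (b i)).support = Finset.univ.image f := by
  classical
  ext x
  simp only [Finset.mem_image, Finset.mem_univ, true_and, Finsupp.mem_support_iff]
  constructor
  · intro hx
    rw [Finsupp.finsetSum_apply] at hx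
    obtain ⟨i, -, hi⟩ := Finset.exists_ne_zero_of_sum_ne_zero hx
    refine ⟨i, ?_⟩
    by_contra hne
    exact hi (Finsupp.single_eq_of_ne fun h => hne h.symm)
  · rintro ⟨j, rfl⟩
    rw [sum_single_apply hf]
    exact (hb j).ne'

theorem sort_image_eq_ofFn {k : ℕ} {f : Fin k → ℕ+} (hf : StrictMono f) :
    (Finset.univ.image f).sort (· ≤ ·) = List.ofFn f := by
  have h1 : (Finset.univ.image f) = (List.ofFn f).toFinset := by
    ext x
    simp [List.mem_ofFn]
  rw [h1]
  exact (List.toFinset_sort (· ≤ ·) (List.nodup_ofFn.2 hf.injective)).2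
    (List.pairwise_ofFn.2 fun _ _ h => (hf h).le)

/-- A strictly increasing choice of variables that produces `x ^ d` must be the increasing
enumeration of the support of `d`. So there is at most one, and it exists exactly when `β` lists the
nonzero exponents. -/
theorem monomialQSym_apply {n : ℕ} (β : Composition n) (d : ℕ+ →₀ ℕ) :
    monomialQSym β d = if β.blocks = exponents d then 1 else 0 := by
  have key : ∀ f : {f : Fin β.length → ℕ+ // StrictMono f},
      ∑ j, Finsupp.single (f.1 j) (β.blocksFun j) = d →
      List.ofFn f.1 = d.support.sort (· ≤ ·) ∧ β.blocks = exponents d := by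
    rintro ⟨f, hf⟩ rfl
    have h1 : List.ofFn f = (∑ j, Finsupp.single (f j) (β.blocksFun j)).support.sort (· ≤ ·) := by
      rw [support_sum_single hf fun i => β.one_le_blocksFun i, sort_image_eq_ofFn hf]
    refine ⟨h1, ?_⟩
    rw [exponents, ← h1, List.map_ofFn, ← Composition.ofFn_blocksFun]
    congr 1
    funext j
    exact (sum_single_apply hf β.blocksFun j).symm
  rw [monomialQSym, monomialSum]
  split_ifs with hβ
  · rw [Nat.cast_eq_one, Nat.card_eq_one_iff_unique]
    have hlen : d.support.card = β.length := by
      rw [← Composition.blocks_length, hβ, exponents, List.length_map, Finset.length_sort]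
    set g := d.support.orderEmbOfFin hlen with hg
    have hgd : ∀ j, d (g j) = β.blocksFun j := by
      intro j
      have : β.blocksFun j = β.blocks[(j : ℕ)] := rfl
      rw [this, List.getElem_of_eq hβ]
      simp only [exponents, List.getElem_map]
      rfl
    refine ⟨⟨fun f f' => ?_⟩, ⟨⟨⟨g, g.strictMono⟩, ?_⟩⟩⟩
    · refine Subtype.ext (Subtype.ext (List.ofFn_injective ?_))
      rw [(key f.1 f.2).1, (key f'.1 f'.2).1]
    · have hs := support_sum_single g.strictMono (b := β.blocksFun)
        fun i => β.one_le_blocksFun i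
      have himg : Finset.univ.image g = d.support := Finset.image_orderEmbOfFin_univ _ _
      refine Finsupp.ext fun x => ?_
      by_cases hx : x ∈ d.support
      · rw [← himg] at hx
        obtain ⟨j, -, rfl⟩ := Finset.mem_image.1 hx
        exact (sum_single_apply g.strictMono _ j).trans (hgd j).symm
      · rw [Finsupp.notMem_support_iff.1 hx]
        refine Finsupp.notMem_support_iff.1 ?_
        rwa [hs, himg]
  · rw [Nat.cast_eq_zero]
    have : IsEmpty {f : {f : Fin β.length → ℕ+ // StrictMono f} //
        ∑ j, Finsupp.single (f.1 j) (β.blocksFun j) = d} :=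
      ⟨fun f => hβ (key f.1 f.2).2⟩
    exact Nat.card_of_isEmpty

/-! ### The expansion of skew Schur functions -/

theorem BorderStripTableau.card_skewCells {lam mu : YoungDiagram} {n : ℕ} {α : Composition n}
    (T : BorderStripTableau lam mu α) : (skewCells lam mu).card = n := by
  classical
  -- Cells are counted by label, shifted to list positions; the truncated subtraction loses nothing
  -- because labels on the shape are at least 1.
  have h1 : ∀ c ∈ skewCells lam mu, extendZero T.entry c - 1 ∈ Finset.range α.blocks.length := by
    intro c hc
    have h1 : (T.entry ⟨c, hc⟩ : ℕ) ≤ α.blocks.length := T.entry_le _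
    have h2 : 1 ≤ (T.entry ⟨c, hc⟩ : ℕ) := (T.entry ⟨c, hc⟩).2
    rw [extendZero_apply T.entry ⟨c, hc⟩, Finset.mem_range]
    omega
  rw [Finset.card_eq_sum_card_fiberwise h1]
  have h2 : ∀ i ∈ Finset.range α.blocks.length,
      ((skewCells lam mu).filter fun c => extendZero T.entry c - 1 = i).card =
        α.blocks.getD i 0 := by
    intro i _
    have := T.card_occupied i.succPNat
    rw [Nat.succPNat_coe, Nat.succ_sub_one] at this
    rw [← this, ← level_extendZero, level]
    congr 1
    refine Finset.filter_congr fun c hc => ?_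
    have h2 : 1 ≤ (T.entry ⟨c, hc⟩ : ℕ) := (T.entry ⟨c, hc⟩).2
    rw [extendZero_apply T.entry ⟨c, hc⟩, Nat.succPNat_coe]
    omega
  rw [Finset.sum_congr rfl h2, Finset.sum_range]
  conv_rhs => rw [← α.blocks_sum]
  rw [← List.sum_ofFn]
  congr 1
  refine List.ext_getElem (by simp) fun i hi hi' => ?_
  rw [List.getElem_ofFn]
  exact List.getD_eq_getElem _ _ hi'

theorem chi_eq_zero {lam mu : YoungDiagram} {n : ℕ} (α : Composition n)
    (h : (skewCells lam mu).card ≠ n) : chi lam mu α = 0 :=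
  Finset.sum_eq_zero fun T _ => absurd T.card_skewCells h

theorem SkewSSYT.sum_exponents {lam mu : YoungDiagram} (T : SkewSSYT lam mu) :
    (exponents T.content).sum = (skewCells lam mu).card := by
  have h1 : (exponents T.content).sum = T.content.sum fun _ k => k := by
    rw [exponents, ← Multiset.sum_coe, ← Multiset.map_coe, Finset.sort_eq]
    rfl
  rw [h1, SkewSSYT.content, ← Finsupp.sum_finsetSum_index (fun _ => rfl) fun _ _ _ => rfl]
  simp

theorem psi_apply {n : ℕ} (α : Composition n) (d : ℕ+ →₀ ℕ) : psi α d =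
    ∑ b : Composition α.length, (coarseningProd α b : ℂ)⁻¹ * monomialQSym (α.gather b) d := by
  rw [psi]
  exact Finset.sum_apply _ _ _

/-- With `β` the list of nonzero exponents of `d`, the left side is an entry of `H_β`. Among the
monomial functions in `psi α`, only those with `α.gather b = β` contribute at `d`, which are the
terms of `prod_eq_sum_gather`. -/
theorem skewSchur_apply_eq_sum {lam mu : YoungDiagram} (hmu : mu ≤ lam) (d : ℕ+ →₀ ℕ) {n : ℕ}
    (hn : (exponents d).sum = n) : skewSchur lam mu d =
      ∑ α : Composition n, (chi lam mu α : ℂ) * psi α d := by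
  classical
  let β : Composition n := ⟨exponents d, by
    intro i hi
    obtain ⟨x, hx, rfl⟩ := List.mem_map.1 hi
    exact Nat.pos_of_ne_zero (Finsupp.mem_support_iff.1 ((Finset.mem_sort _).1 hx)), hn⟩
  have h := prod_eq_sum_gather (fun k => stepMatrix lam (horizontalWeight k))
    (fun k => stepMatrix lam (borderWeight k))
    (eq_sum_composition _ _ (stepMatrix_horizontalWeight_zero lam)
      (smul_stepMatrix_horizontalWeight lam)) β
  rw [skewSchur_apply hmu]
  refine (congrFun (congrFun h ⟨mu, hmu⟩) ⟨lam, Set.mem_Iic.2 le_rfl⟩).trans ?_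
  rw [Matrix.sum_apply]
  refine Finset.sum_congr rfl fun α _ => ?_
  rw [Matrix.sum_apply, psi_apply, Finset.mul_sum]
  refine Finset.sum_congr rfl fun b _ => ?_
  rw [monomialQSym_apply, chi_eq_borderProd hmu]
  have hβ : α.gather b = β ↔ (α.gather b).blocks = exponents d := Composition.ext_iff
  by_cases hb : α.gather b = β
  · rw [if_pos hb, if_pos (hβ.1 hb), Matrix.smul_apply, smul_eq_mul, mul_one, mul_comm]
    rfl
  · rw [if_neg hb, if_neg (fun h => hb (hβ.2 h)), mul_zero, mul_zero]
    rfl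

theorem psi_apply_eq_zero {n : ℕ} (α : Composition n) (d : ℕ+ →₀ ℕ)
    (h : (exponents d).sum ≠ n) : psi α d = 0 := by
  rw [psi_apply]
  refine Finset.sum_eq_zero fun b _ => ?_
  rw [monomialQSym_apply, if_neg, mul_zero]
  intro hb
  exact h (by rw [← hb, Composition.blocks_sum])

theorem skewSchur_eq_sum {lam mu : YoungDiagram} (hmu : mu ≤ lam) :
    skewSchur lam mu = ∑ α : Composition (skewCells lam mu).card,
      (chi lam mu α : ℂ) • psi α := by
  funext d
  have hsum : (∑ α : Composition (skewCells lam mu).card, (chi lam mu α : ℂ) • psi α) d =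
      ∑ α : Composition (skewCells lam mu).card, (chi lam mu α : ℂ) * psi α d :=
    Finset.sum_apply _ _ _
  rw [hsum]
  by_cases hd : (exponents d).sum = (skewCells lam mu).card
  · exact skewSchur_apply_eq_sum hmu d hd
  -- Both sides are homogeneous of degree the size of the shape, so any other degree gives zero.
  · rw [Finset.sum_eq_zero fun α _ => by rw [psi_apply_eq_zero α d hd, mul_zero]]
    have : IsEmpty {T : SkewSSYT lam mu // T.content = d} :=
      ⟨fun T => hd (by rw [← T.2, T.1.sum_exponents])⟩
    rw [skewSchur, monomialSum, Nat.card_of_isEmpty, Nat.cast_zero]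

end PsiMN

theorem mainTheorem9 (lam mu : YoungDiagram) (hmu : mu ≤ lam) :
    {α : Σ n : ℕ, Composition n | PsiMN.chi lam mu α.2 ≠ 0}.Finite ∧
    PsiMN.skewSchur lam mu =
      ∑ᶠ α : Σ n : ℕ, Composition n, (PsiMN.chi lam mu α.2 : ℂ) • PsiMN.psi α.2 := by
  classical
  -- Tableaux exist only for compositions of the size of the shape; this gives finiteness and
  -- reduces the `finsum` to a finite sum over that one degree.
  have hmem : ∀ α : Σ n : ℕ, Composition n, PsiMN.chi lam mu α.2 ≠ 0 →
      α ∈ (Finset.univ : Finset (Composition (PsiMN.skewCells lam mu).card)).map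
        (Function.Embedding.sigmaMk _) := by
    rintro ⟨n, α⟩ h
    obtain rfl : (PsiMN.skewCells lam mu).card = n := by
      by_contra hne
      exact h (PsiMN.chi_eq_zero α hne)
    exact Finset.mem_map_of_mem _ (Finset.mem_univ _)
  refine ⟨(Finset.finite_toSet _).subset hmem, ?_⟩
  rw [finsum_eq_sum_of_support_subset _ (s := (Finset.univ :
      Finset (Composition (PsiMN.skewCells lam mu).card)).map (Function.Embedding.sigmaMk _)),
    Finset.sum_map, PsiMN.skewSchur_eq_sum hmu]
  · rfl
  · intro α hα
    refine hmem α fun h => hα ?_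
    simp only [h, Int.cast_zero, zero_smul]
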